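/- **Theorem (surgery is reverse connected sum).** Let $n\ge 2$. There are $\varepsilon_0>0$ and an integer $k_0\ge 1$, depending only on $n$, such that the following holds for all $\Lambda\ge 10$, $0<\varepsilon\le\varepsilon_0$, $k\ge k_0$, $0<\tau<1$, $B>10\Lambda$ and all codimensions $m$. Let $F:\mathcal M\to\mathbb R^{n+m}$ be a smooth immersion of a connected closed smooth $n$-manifold, let $N:\mathbb S^{n-1}\times[-4\Lambda,4\Lambda]\to\mathcal M$ be a normal $(\varepsilon,k)$-submanifold neck, and let the smooth immersion $\tilde F:\tilde{\mathcal M}\to\mathbb R^{n+m}$ of a closed smooth $n$-manifold result from $F$ by the standard surgery with parameters $\tau,B$ at the cross section $z=0$ of $N$. 1. If $\tilde{\mathcal M}$ is connected, then $\mathcal M$ is diffeomorphic to a connected sum of $\tilde{\mathcal M}$ with itself. 2. If $\tilde{\mathcal M}$ is disconnected, then it has exactly two components $\tilde{\mathcal M}_1,\tilde{\mathcal M}_2$, and $\mathcal M$ is diffeomorphic to a connected sum of $\tilde{\mathcal M}_1$ and $\tilde{\mathcal M}_2$. In particular, if $\tilde{\mathcal M}_2$ (either of the two components) is diffeomorphic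 to $\mathbb S^n$, then $\tilde{\mathcal M}_1$ (the other one) is diffeomorphic to $\mathcal M$. **Necks.** $N:\mathbb S^{n-1}\times[a,b]\to\mathcal M$ is a smooth embedding. Let $g$ be the metric induced by $F$, $\bar g$ the standard metric of the cylinder, $\Sigma_z=N(\mathbb S^{n-1}\times\{z\})$, $\sigma_{n-1}$ the area of the unit sphere, and $r(z)$ the mean radius, $|\Sigma_z|_g=\sigma_{n-1}r(z)^{n-1}$. Let $h=-(D^2F)^{\perp}$ be the second fundamental form (vector valued, with the sign for which it points outwards on round cylinders), $H=\operatorname{tr}_g h$, $|A|=|h|$, $\nu^+=H/|H|$. * $N$ is $(\varepsilon,k)$-*geometric* if $\hat g=r^{-2}g$ satisfies $|\hat g-\bar g|_{\bar g}\le\varepsilon$ and $|\bar D^j\hat g|_{\bar g}\le\varepsilon$ for $1\le j\le k$, and $|(d/dz)^j\log r|\le\varepsilon$ for $1\le j\le k$. * $N$ is a *submanifold neck* if moreover there is a unit normal field $\nu$ such that, for $h_\nu=\langle h,\nu\rangle$ with Weingarten map $W_\nu$ and $W_-=h-h_\nu\nu$, one has $|W_\nu-r^{-1}\bar W|\le\varepsilon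 r^{-1}$, $|W_-|\le\varepsilon r^{-1}$, and $|\nabla^l h|\le\varepsilon r^{-l-1}$ for $1\le l\le k$; here $\bar W$ is the identity in the sphere directions and $0$ in the axis direction, and norms are those of $g$. * $N$ is *normal* if each $\Sigma_z$ has constant mean curvature in $(\mathcal M,g)$; each $N|_{\mathbb S^{n-1}\times\{z\}}$, from the standard metric to the metric of $\Sigma_z$, is harmonic; $\operatorname{vol}_g(\mathbb S^{n-1}\times[v,w])=\sigma_{n-1}\int_v^w r^n\,dz$ for $a\le v\le w\le b$; and $\int_{\mathbb S^{n-1}\times\{z\}}\bar g(\bar V,U)\,d\bar\mu=0$ for each Killing field $\bar V$ of $\mathbb S^{n-1}\times\{z\}$, where $U$ is the unit normal of $\Sigma_z$ in $(\mathcal M,g)$ pointing to increasing $z$, and $\bar\mu$ is the standard measure. **Standard surgery at $z=0$.** Put $r_0=r(0)$. The approximating straight cylinder is $\bar C(\omega,z)=x_0+r_0(Q\omega+z e)$, where $x_0$ is the centre of mass of $\Sigma_0$, $e$ is the unit vector in the direction of the mean of $U$ over $\Sigma_0$ (both with respect to the induced measure), and $Q$ is a linear isometric embedding of $\mathbb R^n$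 into $e^\perp$ minimizing $\int_{\Sigma_0}|F\circ N(\omega,0)-x_0-r_0Q\omega|^2$ among all such embeddings. Let $\varphi:[0,4\Lambda]\to[0,1]$ be smooth and nonincreasing, $\varphi=1$ on $[0,2\Lambda]$, $\varphi=0$ on $[3\Lambda,4\Lambda]$. For each half of the neck put $z=s(\zeta-4\Lambda)$, $\zeta\in[0,4\Lambda]$, with $s=1$ for $z\le0$ and $s=-1$ for $z\ge0$. For each half choose $z_1\in(3\Lambda,4\Lambda]$ and a function $u$, smooth for $\zeta<z_1$, with $u=0$ for $\zeta\le\Lambda$, $u(\zeta)=r_0\exp(-B/(\zeta-\Lambda))$ for $\Lambda<\zeta\le3\Lambda$, $\tau u<r_0$ for $\zeta<z_1$ and $\tau u\to r_0$ as $\zeta\to z_1$, such that $\tilde C(\omega,\zeta)=\bar C(\omega,z)-\tau u(\zeta)Q\omega$ is uniformly spherically pinched on $[3\Lambda,z_1)$: $|A|^2-\frac1{n-1}|H|^2\le-\delta$ for some $\delta>0$. Put $$\hat N(\omega,\zeta)=\varphi(\zeta)\bigl(F\circ N(\omega,z)-\tau u(\zeta)\nu^+(\omega,z)\bigr)+(1-\varphi(\zeta))\,\tilde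 C(\omega,\zeta),\qquad 0<\zeta<z_1.$$ That $\tilde F:\tilde{\mathcal M}\to\mathbb R^{n+m}$ results from the surgery means: $\tilde{\mathcal M}$ is the union of a smoothly and openly embedded copy of $\mathcal M\setminus N(\mathbb S^{n-1}\times[-3\Lambda,3\Lambda])$, on which $\tilde F=F$, and of two disjoint smoothly and openly embedded open unit balls, one for each half of the neck. On each of them, in polar coordinates $x=t\omega$ and for a smooth function $\theta$ of $(0,1)$ onto $(0,z_1)$ with $\theta'<0$, one has $\tilde F(t\omega)=\hat N(\omega,\theta(t))$. The ball and the copy of $\mathcal M\setminus N(\mathbb S^{n-1}\times[-3\Lambda,3\Lambda])$ intersect exactly in the collar $0<\zeta<\Lambda$, where $t\omega$ is the point $N(\omega,z)$ with $\zeta=\theta(t)$. **Connected sums.** For smoothly embedded closed $n$-discs $i_1$ in $\mathcal M_1$ and $i_2$ in $\mathcal M_2$ (parametrized by the unit ball), the connected sum is obtained from the disjoint union of $\mathcal M_1\setminus i_1(0)$ and $\mathcal M_2\setminus i_2(0)$ by identifying $i_1(t\omega)$ with $i_2((1-t)\omega)$ for $0<t<1$, $|\omega|=1$. For two disjoint discs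 $i_1,i_2$ in one manifold $\tilde{\mathcal M}$, the same identification in $\tilde{\mathcal M}\setminus\{i_1(0),i_2(0)\}$ gives a connected sum of $\tilde{\mathcal M}$ with itself. No manifold is assumed to be orientable or oriented; "a connected sum" means one for some choice of the discs. -/

import Mathlib

open Set MeasureTheory
open scoped Manifold ContDiff

noncomputable section

namespace NeckSurgery

/-- Euclidean space `ℝⁿ`. -/
abbrev Euc (n : ℕ) := EuclideanSpace ℝ (Fin n)

/-- The Euclidean space `ℝⁿ × ℝ`, which contains the standard cylinder `S^{n-1} × ℝ`. -/
abbrev Cyl (n : ℕ) := WithLp 2 (Euc n × ℝ)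

/-- The point `(x, z)` of `ℝⁿ × ℝ`. -/
def pt {n : ℕ} (x : Euc n) (z : ℝ) : Cyl n := WithLp.toLp 2 (x, z)

/-- The set `(ℝⁿ ∖ 0) × I`, which retracts radially onto the cylinder `S^{n-1} × I`. -/
def tube (n : ℕ) (I : Set ℝ) : Set (Cyl n) := {p | p.fst ≠ 0 ∧ p.snd ∈ I}

/-- A map `f` on the cylinder `S^{n-1} × I` is written as a function `f ξ z`, of which only the
values at unit vectors `ξ` matter. Its extension to `(ℝⁿ ∖ 0) × I` is constant along rays; `f` is
smooth on the cylinder iff this extension is smooth, and the derivatives of the extension in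
directions tangent to the cylinder are those of `f`. -/
def radialExt {n : ℕ} {β : Type*} (f : Euc n → ℝ → β) : Cyl n → β :=
  fun p => f (‖p.fst‖⁻¹ • p.fst) p.snd

/-! ### Pointwise linear algebra

`L : D → V` is the differential of a parametrisation that is constant along the line spanned by
`ρ`, and is injective on the orthogonal complement of `ρ`. -/

section LinearAlgebra

variable {D V : Type*} [NormedAddCommGroup D] [InnerProductSpace ℝ D] [FiniteDimensional ℝ D]
  [NormedAddCommGroup V] [InnerProductSpace ℝ V] [FiniteDimensional ℝ V]

/-- The pulled back metric `⟪L v, L w⟫`, as an operator on `ρᗮ`, made invertible by adding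
`⟪ρ, v⟫ ⟪ρ, w⟫`. For a unit vector `ρ` this is the direct sum of the pulled back metric on `ρᗮ`
and of the identity of the line spanned by `ρ`. -/
def gramOp (L : D →L[ℝ] V) (ρ : D) : D →L[ℝ] D :=
  haveI : CompleteSpace D := FiniteDimensional.complete ℝ D
  haveI : CompleteSpace V := FiniteDimensional.complete ℝ V
  (ContinuousLinearMap.adjoint L).comp L + (innerSL ℝ ρ).smulRight ρ

/-- The vector `v ⟂ ρ` for which `L v` is the orthogonal projection of `y` to the range of `L`. -/
def pinv (L : D →L[ℝ] V) (ρ : D) : V →L[ℝ] D :=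
  haveI : CompleteSpace D := FiniteDimensional.complete ℝ D
  haveI : CompleteSpace V := FiniteDimensional.complete ℝ V
  (gramOp L ρ).inverse.comp (ContinuousLinearMap.adjoint L)

/-- The Riemannian density of the pulled back metric with respect to the Euclidean metric of `ρᗮ`
(for a unit vector `ρ`). -/
def jac (L : D →L[ℝ] V) (ρ : D) : ℝ := Real.sqrt (gramOp L ρ).det

end LinearAlgebra

/-! ### Geometry of a parametrised cylinder

`Y : (ℝⁿ ∖ 0) × I → V` is the radial extension of an immersion of `S^{n-1} × I` into a Euclidean
space `V`; `g` denotes the induced metric. -/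

section Geometry

variable {n : ℕ} {V : Type*} [NormedAddCommGroup V] [InnerProductSpace ℝ V]
  [FiniteDimensional ℝ V]

/-- The differential of `Y` (one sided at the ends of `I`). -/
def dMap (Y : Cyl n → V) (I : Set ℝ) (p : Cyl n) : Cyl n →L[ℝ] V :=
  fderivWithin ℝ Y (tube n I) p

/-- The second derivative `D²Y(v, w)`. -/
def d2Map (Y : Cyl n → V) (I : Set ℝ) (p v w : Cyl n) : V :=
  fderivWithin ℝ (fun q => dMap Y I q v) (tube n I) p w

/-- The vector tangent to the cylinder which `dY` maps to the tangential part of `y`. -/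
def lift (Y : Cyl n → V) (I : Set ℝ) (p : Cyl n) : V →L[ℝ] Cyl n :=
  pinv (dMap Y I p) (pt p.fst 0)

/-- The orthogonal projection of `V` to the tangent space of the immersion at `p`. -/
def tanProj (Y : Cyl n → V) (I : Set ℝ) (p : Cyl n) (y : V) : V := dMap Y I p (lift Y I p y)

/-- The orthogonal projection of `V` to the normal space of the immersion at `p`. -/
def norProj (Y : Cyl n → V) (I : Set ℝ) (p : Cyl n) (y : V) : V := y - tanProj Y I p y

/-- The vector valued second fundamental form `h`, with the sign `h = - (D²Y)^⊥` (so that it points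
outwards on a round cylinder), as a tensor on `V` through the tangential projection. -/
def sff (Y : Cyl n → V) (I : Set ℝ) (p : Cyl n) (y : Fin 2 → V) : V :=
  -norProj Y I p (d2Map Y I p (lift Y I p (y 0)) (lift Y I p (y 1)))

/-- The mean curvature vector `H = tr_g h`. -/
def meanCurv (Y : Cyl n → V) (I : Set ℝ) (p : Cyl n) : V :=
  ∑ a, sff Y I p (fun _ => stdOrthonormalBasis ℝ V a)

/-- The principal normal `ν⁺ = H / |H|`. -/
def principalNormal (Y : Cyl n → V) (I : Set ℝ) (p : Cyl n) : V :=
  ‖meanCurv Y I p‖⁻¹ • meanCurv Y I p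

/-- The squared norm of a tensor. A covariant tensor on the tangent space of the immersion
is evaluated on vectors of `V` through the tangential projection, so that the sum over an
orthonormal basis of `V` is its squared norm with respect to `g`. -/
def tensorNormSq {W : Type*} [NormedAddCommGroup W] {k : ℕ} (A : Cyl n → (Fin k → V) → W)
    (p : Cyl n) : ℝ :=
  ∑ i : Fin k → Fin (Module.finrank ℝ V), ‖A p (fun j => stdOrthonormalBasis ℝ V (i j))‖ ^ 2

/-- The covariant derivative of a tensor field along the immersion, with the Levi-Civita connection
of `g` in the arguments and the connection `Q ∘ d` in the values (`Q` is the normal projection for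
tensors with values in the normal bundle, the identity for scalar tensors). -/
def covDeriv {W : Type*} [NormedAddCommGroup W] [NormedSpace ℝ W] (Y : Cyl n → V) (I : Set ℝ)
    (Q : Cyl n → W → W) {k : ℕ} (A : Cyl n → (Fin k → V) → W) :
    Cyl n → (Fin (k + 1) → V) → W :=
  fun p y => Q p (fderivWithin ℝ (fun q => A q (fun i => tanProj Y I p (y i.succ)))
    (tube n I) p (lift Y I p (y 0)))

/-- The iterated covariant derivative `∇ˡ A`. -/
def iterCovDeriv {W : Type*} [NormedAddCommGroup W] [NormedSpace ℝ W] (Y : Cyl n → V) (I : Set ℝ)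
    (Q : Cyl n → W → W) {k : ℕ} (A : Cyl n → (Fin k → V) → W) :
    (l : ℕ) → Cyl n → (Fin (k + l) → V) → W
  | 0 => A
  | l + 1 => covDeriv Y I Q (iterCovDeriv Y I Q A l)

/-! #### Cross sections `Σ_z = Y(S^{n-1} × {z})` -/

/-- The differential of `Y(·, z)` at `x`. -/
def dSlice (Y : Cyl n → V) (z : ℝ) (x : Euc n) : Euc n →L[ℝ] V :=
  fderiv ℝ (fun x' => Y (pt x' z)) x

/-- The second derivative of `Y(·, z)` at `x`. -/
def d2Slice (Y : Cyl n → V) (z : ℝ) (x v w : Euc n) : V :=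
  fderiv ℝ (fun x' => dSlice Y z x' v) x w

/-- The standard surface measure of the unit sphere `S^{n-1}`. -/
def sphereMeasure (n : ℕ) : Measure (Metric.sphere (0 : Euc n) 1) :=
  (volume : Measure (Euc n)).toSphere

/-- The area `σ_{n-1}` of the unit sphere `S^{n-1}`. -/
def sphereArea (n : ℕ) : ℝ := (sphereMeasure n).real univ

/-- The area of the cross section `Σ_z` in the induced metric. -/
def sliceArea (Y : Cyl n → V) (z : ℝ) : ℝ :=
  ∫ ξ, jac (dSlice Y z (ξ : Euc n)) (ξ : Euc n) ∂(sphereMeasure n)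

/-- The mean radius `r(z)`, defined by `|Σ_z| = σ_{n-1} r(z)^{n-1}`. -/
def meanRadius (Y : Cyl n → V) (z : ℝ) : ℝ :=
  (sliceArea Y z / sphereArea n) ^ (((n : ℝ) - 1)⁻¹)

/-- The unit normal `U` of `Σ_z` in the immersed cylinder with its induced metric, in the direction
of increasing `z`, as a vector of `V`. -/
def sliceNormal (Y : Cyl n → V) (I : Set ℝ) (p : Cyl n) : V :=
  let L := dSlice Y p.snd p.fst
  let t := dMap Y I p (pt 0 1)
  let w := t - L (pinv L p.fst t)
  ‖w‖⁻¹ • w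

/-- The mean curvature of `Σ_z` in the immersed cylinder with its induced metric. -/
def sliceMeanCurv (Y : Cyl n → V) (I : Set ℝ) (p : Cyl n) : ℝ :=
  ∑ a, -inner ℝ
    (d2Slice Y p.snd p.fst
      (pinv (dSlice Y p.snd p.fst) p.fst (stdOrthonormalBasis ℝ V a))
      (pinv (dSlice Y p.snd p.fst) p.fst (stdOrthonormalBasis ℝ V a)))
    (sliceNormal Y I p)

/-! ### Necks -/

/-- The standard cylinder `S^{n-1} × ℝ ⊂ ℝⁿ × ℝ`, extended radially; its induced metric
is `ḡ`. -/
def stdCyl (n : ℕ) : Cyl n → Cyl n := radialExt pt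

/-- The difference `r(z)⁻² g - ḡ`, as a tensor on the standard cylinder. -/
def metricDefect (Y : Cyl n → V) (I : Set ℝ) (p : Cyl n) (y : Fin 2 → Cyl n) : ℝ :=
  (meanRadius Y p.snd ^ 2)⁻¹ *
      inner ℝ (dMap Y I p (lift (stdCyl n) I p (y 0))) (dMap Y I p (lift (stdCyl n) I p (y 1)))
    - inner ℝ (tanProj (stdCyl n) I p (y 0)) (tanProj (stdCyl n) I p (y 1))

/-- Intrinsic `(ε, k)`-geometric necks. Since `ḡ` is parallel for its own connection, the bound on
the derivatives of `ĝ = r⁻² g` is a bound on the derivatives of `ĝ - ḡ`. -/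
structure IsGeometricNeck (Y : Cyl n → V) (a b ε : ℝ) (k : ℕ) : Prop where
  metric_close : ∀ j ≤ k, ∀ ξ : Euc n, ‖ξ‖ = 1 → ∀ z ∈ Icc a b,
    tensorNormSq (iterCovDeriv (stdCyl n) (Icc a b) (fun _ w => w)
      (metricDefect Y (Icc a b)) j) (pt ξ z) ≤ ε ^ 2
  radius_close : ∀ j : ℕ, 1 ≤ j → j ≤ k → ∀ z ∈ Icc a b,
    |iteratedDerivWithin j (fun z' => Real.log (meanRadius Y z')) (Icc a b) z| ≤ ε

/-- Normal necks. -/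
structure IsNormalNeck (Y : Cyl n → V) (a b : ℝ) : Prop where
  /-- Each cross section has constant mean curvature. -/
  constant_mean_curvature : ∀ z ∈ Icc a b, ∃ c : ℝ, ∀ ξ : Euc n, ‖ξ‖ = 1 →
    sliceMeanCurv Y (Icc a b) (pt ξ z) = c
  /-- `S^{n-1} → Σ_z` is harmonic: the part of the spherical Laplacian of `Y(·, z)` that
  is tangent to `Σ_z` vanishes. -/
  harmonic : ∀ z ∈ Icc a b, ∀ ξ : Euc n, ‖ξ‖ = 1 → ∀ v : Euc n,
    inner ℝ (∑ i, d2Slice Y z ξ (EuclideanSpace.basisFun (Fin n) ℝ i)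
      (EuclideanSpace.basisFun (Fin n) ℝ i)) (dSlice Y z ξ v) = 0
  /-- The volume of each subcylinder is `σ_{n-1} ∫ r(z)ⁿ dz`. -/
  volume_eq : ∀ v ∈ Icc a b, ∀ w ∈ Icc a b, v ≤ w →
    ∫ z in v..w, ∫ ξ, jac (dMap Y (Icc a b) (pt (ξ : Euc n) z)) (pt (ξ : Euc n) 0)
        ∂(sphereMeasure n)
      = sphereArea n * ∫ z in v..w, meanRadius Y z ^ n
  /-- The unit normal `U` of the cross sections is orthogonal, with respect to the standard metric
  and measure, to the Killing fields `ξ ↦ K ξ` (`K` skew symmetric) of the sphere. -/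
  killing : ∀ z ∈ Icc a b, ∀ K : Euc n →L[ℝ] Euc n, (∀ x, inner ℝ (K x) x = 0) →
    ∫ ξ, inner ℝ (K (ξ : Euc n)) (lift Y (Icc a b) (pt (ξ : Euc n) z)
        (sliceNormal Y (Icc a b) (pt (ξ : Euc n) z))).fst ∂(sphereMeasure n) = 0

/-- The component `W_ν - r⁻¹ W̄` as a bilinear form, where `W̄` is the Weingarten map of the standard
cylinder: the identity in the directions of the sphere, zero in the direction of the axis. -/
def weingartenDefect (Y : Cyl n → V) (I : Set ℝ) (ν : Euc n → ℝ → V) (p : Cyl n)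
    (y : Fin 2 → V) : ℝ :=
  inner ℝ (sff Y I p y) (ν p.fst p.snd) -
    (meanRadius Y p.snd)⁻¹ * inner ℝ (dMap Y I p (pt (lift Y I p (y 0)).fst 0)) (y 1)

/-- The part `W_-` of the second fundamental form in the normal directions orthogonal to `ν`. -/
def sffMinus (Y : Cyl n → V) (I : Set ℝ) (ν : Euc n → ℝ → V) (p : Cyl n) (y : Fin 2 → V) : V :=
  sff Y I p y - (inner ℝ (sff Y I p y) (ν p.fst p.snd) : ℝ) • ν p.fst p.snd

/-- `(ε, k)`-cylindrical submanifold necks. -/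
structure IsSubmanifoldNeck (Y : Cyl n → V) (a b ε : ℝ) (k : ℕ) : Prop where
  geometric : IsGeometricNeck Y a b ε k
  extrinsic : ∃ ν : Euc n → ℝ → V, ∀ ξ : Euc n, ‖ξ‖ = 1 → ∀ z ∈ Icc a b,
    ‖ν ξ z‖ = 1 ∧ (∀ v, inner ℝ (ν ξ z) (dMap Y (Icc a b) (pt ξ z) v) = 0) ∧
    tensorNormSq (weingartenDefect Y (Icc a b) ν) (pt ξ z) ≤ (ε * (meanRadius Y z)⁻¹) ^ 2 ∧
    tensorNormSq (sffMinus Y (Icc a b) ν) (pt ξ z) ≤ (ε * (meanRadius Y z)⁻¹) ^ 2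
  derivatives : ∀ l : ℕ, 1 ≤ l → l ≤ k → ∀ ξ : Euc n, ‖ξ‖ = 1 → ∀ z ∈ Icc a b,
    tensorNormSq (iterCovDeriv Y (Icc a b) (norProj Y (Icc a b)) (sff Y (Icc a b)) l) (pt ξ z)
      ≤ (ε * ((meanRadius Y z)⁻¹) ^ (l + 1)) ^ 2

/-! ### The approximating straight cylinder at the cross section `z = 0` -/

/-- The mean over `Σ_0`, with its induced metric, of a vector field along `Σ_0`. -/
def sliceMean (Y : Cyl n → V) (f : Euc n → V) : V :=
  (sliceArea Y 0)⁻¹ •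
    ∫ ξ, jac (dSlice Y 0 (ξ : Euc n)) (ξ : Euc n) • f (ξ : Euc n) ∂(sphereMeasure n)

/-- The centre of mass of `Σ_0`: a point of the axis. -/
def centre (Y : Cyl n → V) : V := sliceMean Y (fun ξ => Y (pt ξ 0))

/-- The unit vector in the direction of the mean of the unit normal of `Σ_0`: the direction of the
axis. -/
def axisDir (Y : Cyl n → V) (I : Set ℝ) : V :=
  ‖sliceMean Y (fun ξ => sliceNormal Y I (pt ξ 0))‖⁻¹ •
    sliceMean Y (fun ξ => sliceNormal Y I (pt ξ 0))

/-- The squared `L²`-distance between `Σ_0` and the cross section of the straight cylinder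
with frame `Q`. -/
def frameError (Y : Cyl n → V) (Q : Euc n →ₗᵢ[ℝ] V) : ℝ :=
  ∫ ξ, jac (dSlice Y 0 (ξ : Euc n)) (ξ : Euc n) *
    ‖Y (pt (ξ : Euc n) 0) - (centre Y + meanRadius Y 0 • Q (ξ : Euc n))‖ ^ 2 ∂(sphereMeasure n)

/-- `(ξ, z) ↦ centre + r(0) (Q ξ + z axis)` is a straight cylinder with the prescribed
radius and axis that best approximates the neck at `Σ_0`. -/
def IsBestFrame (Y : Cyl n → V) (I : Set ℝ) (Q : Euc n →ₗᵢ[ℝ] V) : Prop :=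
  (∀ x, inner ℝ (Q x) (axisDir Y I) = 0) ∧
  ∀ Q' : Euc n →ₗᵢ[ℝ] V, (∀ x, inner ℝ (Q' x) (axisDir Y I) = 0) →
    frameError Y Q ≤ frameError Y Q'

/-! ### The standard surgery at `z = 0` on a neck over `[-4Λ, 4Λ]`

The two halves of the neck are treated alike, with the coordinate `ζ ∈ [0, 4Λ]` that
increases towards the cross section `Σ_0`: `z = s (ζ - 4Λ)`, where `s = 1` for the half over
`[-4Λ, 0]` and `s = -1` for the half over `[0, 4Λ]`. -/

/-- The transition function: smooth and decreasing on `[0, 4Λ]`, one on `[0, 2Λ]` and zero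
on `[3Λ, 4Λ]`. -/
structure IsTransition (Λ : ℝ) (φ : ℝ → ℝ) : Prop where
  smooth : ContDiffOn ℝ ∞ φ (Icc 0 (4 * Λ))
  antitone : AntitoneOn φ (Icc 0 (4 * Λ))
  eq_one : ∀ ζ ∈ Icc 0 (2 * Λ), φ ζ = 1
  eq_zero : ∀ ζ ∈ Icc (3 * Λ) (4 * Λ), φ ζ = 0

/-- The straight cylinder bent inwards by `τ u`. -/
def bentCylinder (Y : Cyl n → V) (Λ τ : ℝ) (Q : Euc n →ₗᵢ[ℝ] V) (s : ℝ) (u : ℝ → ℝ)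
    (ξ : Euc n) (ζ : ℝ) : V :=
  centre Y + (meanRadius Y 0 - τ * u ζ) • Q ξ +
    (meanRadius Y 0 * (s * (ζ - 4 * Λ))) • axisDir Y (Icc (-(4 * Λ)) (4 * Λ))

/-- The neck bent inwards by `τ u` in the direction of its principal normal. -/
def bentNeck (Y : Cyl n → V) (Λ τ s : ℝ) (u : ℝ → ℝ) (ξ : Euc n) (ζ : ℝ) : V :=
  Y (pt ξ (s * (ζ - 4 * Λ))) -
    (τ * u ζ) • principalNormal Y (Icc (-(4 * Λ)) (4 * Λ)) (pt ξ (s * (ζ - 4 * Λ)))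

/-- The surgically modified half neck: interpolation between the bent neck and
the bent cylinder. -/
def modifiedNeck (Y : Cyl n → V) (Λ τ : ℝ) (φ : ℝ → ℝ) (Q : Euc n →ₗᵢ[ℝ] V) (s : ℝ) (u : ℝ → ℝ)
    (ξ : Euc n) (ζ : ℝ) : V :=
  φ ζ • bentNeck Y Λ τ s u ξ ζ + (1 - φ ζ) • bentCylinder Y Λ τ Q s u ξ ζ

/-- The bending function `u`: it is `r(0) exp(-B / (ζ - Λ))` for `Λ < ζ ≤ 3Λ`, extended by zero
to `ζ ≤ Λ`; beyond `3Λ` it is continued smoothly so that the bent cylinder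
closes up to a uniformly spherically pinched axially symmetric cap, whose tip is reached at
`ζ = z₁ ∈ (3Λ, 4Λ]`. -/
structure IsCapProfile (Y : Cyl n → V) (Λ τ B : ℝ) (Q : Euc n →ₗᵢ[ℝ] V) (s : ℝ)
    (u : ℝ → ℝ) (z₁ : ℝ) : Prop where
  mem : z₁ ∈ Ioc (3 * Λ) (4 * Λ)
  smooth : ContDiffOn ℝ ∞ u (Iio z₁)
  eq_zero : ∀ ζ ≤ Λ, u ζ = 0
  eq_exp : ∀ ζ ∈ Ioc Λ (3 * Λ), u ζ = meanRadius Y 0 * Real.exp (-(B / (ζ - Λ)))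
  radius_pos : ∀ ζ < z₁, τ * u ζ < meanRadius Y 0
  closes : Filter.Tendsto (fun ζ => τ * u ζ) (nhdsWithin z₁ (Iio z₁)) (nhds (meanRadius Y 0))
  pinched : ∃ δ > 0, ∀ ξ : Euc n, ‖ξ‖ = 1 → ∀ ζ ∈ Ico (3 * Λ) z₁,
    tensorNormSq (sff (radialExt (bentCylinder Y Λ τ Q s u)) (Ico (3 * Λ) z₁)) (pt ξ ζ) -
      ((n : ℝ) - 1)⁻¹ *
        ‖meanCurv (radialExt (bentCylinder Y Λ τ Q s u)) (Ico (3 * Λ) z₁) (pt ξ ζ)‖ ^ 2 ≤ -δ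

/-! ### Manifolds -/

/-- Smooth immersions of `n`-manifolds into a Euclidean space. -/
def IsSmoothImmersion {n d : ℕ} {M : Type*} [TopologicalSpace M] [ChartedSpace (Euc n) M]
    (F : M → Euc d) : Prop :=
  ContMDiff (𝓡 n) (𝓡 d) ∞ F ∧ ∀ x, Function.Injective (mfderiv (𝓡 n) (𝓡 d) F x)

/-- A topological neck: a smooth embedding of the cylinder `S^{n-1} × [a, b]` in the `n`-manifold
`M`. The differential of the radial extension of `N` vanishes on the radial direction, so that its
surjectivity means that the differential of `N` is an isomorphism. -/
structure IsTopologicalNeck {n : ℕ} {M : Type*} [TopologicalSpace M] [ChartedSpace (Euc n) M]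
    (N : Euc n → ℝ → M) (a b : ℝ) : Prop where
  smooth : ContMDiffOn 𝓘(ℝ, Cyl n) (𝓡 n) ∞ (radialExt N) (tube n (Icc a b))
  submersive : ∀ p ∈ tube n (Icc a b), Function.Surjective
    (mfderivWithin 𝓘(ℝ, Cyl n) (𝓡 n) (radialExt N) (tube n (Icc a b)) p)
  injective : ∀ ξ ξ' : Euc n, ‖ξ‖ = 1 → ‖ξ'‖ = 1 → ∀ z ∈ Icc a b, ∀ z' ∈ Icc a b,
    N ξ z = N ξ' z' → ξ = ξ' ∧ z = z'

/-- The parametrisation `F ∘ N` of the neck in Euclidean space, extended radially. -/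
def neckMap {n d : ℕ} {M : Type*} (F : M → Euc d) (N : Euc n → ℝ → M) : Cyl n → Euc d :=
  radialExt (fun ξ z => F (N ξ z))

/-- A normal `(ε, k)`-submanifold neck `N : S^{n-1} × [a, b] → M` of the immersion `F`. -/
structure IsNormalSubmanifoldNeck {n d : ℕ} {M : Type*} [TopologicalSpace M]
    [ChartedSpace (Euc n) M] (F : M → Euc d) (N : Euc n → ℝ → M) (a b ε : ℝ) (k : ℕ) : Prop where
  topological : IsTopologicalNeck N a b
  normal : IsNormalNeck (neckMap F N) a b
  submanifold : IsSubmanifoldNeck (neckMap F N) a b ε k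

/-- The part `N(S^{n-1} × [-3Λ, 3Λ])` of `M` which is replaced by the surgery. -/
def core {n : ℕ} {M : Type*} (N : Euc n → ℝ → M) (Λ : ℝ) : Set M :=
  {x | ∃ ξ : Euc n, ‖ξ‖ = 1 ∧ ∃ z ∈ Icc (-(3 * Λ)) (3 * Λ), x = N ξ z}

/-- `c : {x ∈ ℝⁿ | |x| < 1} → M'` is the ball which is attached to the half of the neck with sign
`s` in the surgery, and which consists of the collar `0 < ζ < Λ`, where it is attached
to the unchanged part `j : M ∖ core → M'`, and of the cap. In polar coordinates `x = t ξ`, where the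
radius `t ∈ (0, 1)` is a smooth decreasing function of `ζ ∈ (0, z₁)`, the new immersion `F'` is the
modified neck. -/
def IsAttachedCap {n d : ℕ} {M M' : Type*} [TopologicalSpace M'] [ChartedSpace (Euc n) M']
    (F : M → Euc d) (N : Euc n → ℝ → M) (Λ τ B : ℝ) (φ : ℝ → ℝ) (Q : Euc n →ₗᵢ[ℝ] Euc d)
    (F' : M' → Euc d) (j : M → M') (s : ℝ) (c : Euc n → M') : Prop :=
  ∃ (u θ : ℝ → ℝ) (z₁ : ℝ),
    IsCapProfile (neckMap F N) Λ τ B Q s u z₁ ∧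
    ContDiffOn ℝ ∞ θ (Ioo 0 1) ∧ (∀ t ∈ Ioo (0 : ℝ) 1, deriv θ t < 0) ∧
    θ '' Ioo 0 1 = Ioo 0 z₁ ∧
    IsLocalDiffeomorphOn (𝓡 n) (𝓡 n) ∞ c (Metric.ball 0 1) ∧ InjOn c (Metric.ball 0 1) ∧
    (∀ ξ : Euc n, ‖ξ‖ = 1 → ∀ t ∈ Ioo (0 : ℝ) 1,
      F' (c (t • ξ)) = modifiedNeck (neckMap F N) Λ τ φ Q s u ξ (θ t)) ∧
    (∀ ξ : Euc n, ‖ξ‖ = 1 → ∀ t ∈ Ioo (0 : ℝ) 1, θ t < Λ →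
      c (t • ξ) = j (N ξ (s * (θ t - 4 * Λ)))) ∧
    (∀ x ∉ core N Λ, j x ∈ c '' Metric.ball 0 1 →
      ∃ ξ : Euc n, ‖ξ‖ = 1 ∧ ∃ ζ ∈ Ioo 0 Λ, x = N ξ (s * (ζ - 4 * Λ)))

/-- The immersed manifold `F' : M' → ℝᵈ` results from the immersed manifold `F : M → ℝᵈ` by the
standard surgery with parameters `τ, B` at the cross section `z = 0` of the neck
`N : S^{n-1} × [-4Λ, 4Λ] → M`: the complement of `N(S^{n-1} × [-3Λ, 3Λ])` is unchanged, and a ball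
is attached to each of its two collars. -/
def IsStandardSurgery {n d : ℕ} {M M' : Type*} [TopologicalSpace M] [ChartedSpace (Euc n) M]
    [TopologicalSpace M'] [ChartedSpace (Euc n) M'] (F : M → Euc d) (N : Euc n → ℝ → M)
    (Λ τ B : ℝ) (F' : M' → Euc d) : Prop :=
  ∃ (φ : ℝ → ℝ) (Q : Euc n →ₗᵢ[ℝ] Euc d) (j : M → M') (c₁ c₂ : Euc n → M'),
    IsTransition Λ φ ∧
    IsBestFrame (neckMap F N) (Icc (-(4 * Λ)) (4 * Λ)) Q ∧
    IsLocalDiffeomorphOn (𝓡 n) (𝓡 n) ∞ j (core N Λ)ᶜ ∧ InjOn j (core N Λ)ᶜ ∧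
    (∀ x ∉ core N Λ, F' (j x) = F x) ∧
    IsAttachedCap F N Λ τ B φ Q F' j 1 c₁ ∧
    IsAttachedCap F N Λ τ B φ Q F' j (-1) c₂ ∧
    Disjoint (c₁ '' Metric.ball 0 1) (c₂ '' Metric.ball 0 1) ∧
    j '' (core N Λ)ᶜ ∪ c₁ '' Metric.ball 0 1 ∪ c₂ '' Metric.ball 0 1 = univ

/-- `x₁` and `x₂` are identified in the connected sum along the discs `i₁` and `i₂`:
`x₁ = i₁ (t ξ)` and `x₂ = i₂ ((1 - t) ξ)` with `|ξ| = 1` and `0 < t < 1`. -/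
def Glued {n : ℕ} {M₁ M₂ : Type*} (i₁ : Euc n → M₁) (i₂ : Euc n → M₂) (x₁ : M₁) (x₂ : M₂) : Prop :=
  ∃ ξ : Euc n, ‖ξ‖ = 1 ∧ ∃ t ∈ Ioo (0 : ℝ) 1, x₁ = i₁ (t • ξ) ∧ x₂ = i₂ ((1 - t) • ξ)

/-- A smoothly embedded disc of full dimension: the restriction to the closed unit ball of a smooth
open embedding of `ℝⁿ`. -/
def IsDisc {n : ℕ} {M : Type*} [TopologicalSpace M] [ChartedSpace (Euc n) M]
    (i : Euc n → M) : Prop :=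
  IsLocalDiffeomorph (𝓡 n) (𝓡 n) ∞ i ∧ Function.Injective i

/-- `M` is diffeomorphic to a connected sum of `M₁` and `M₂`: for embedded discs `i₁`, `i₂`,
it is the smooth manifold obtained from the disjoint union of `M₁ ∖ i₁(0)` and `M₂ ∖ i₂(0)` by
identifying `i₁ (t ξ)` with `i₂ ((1 - t) ξ)`. The maps `f₁`, `f₂` are the inclusions of the
two open pieces. -/
def IsConnectedSum (n : ℕ) (M₁ M₂ M : Type*)
    [TopologicalSpace M₁] [ChartedSpace (Euc n) M₁] [TopologicalSpace M₂] [ChartedSpace (Euc n) M₂]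
    [TopologicalSpace M] [ChartedSpace (Euc n) M] : Prop :=
  ∃ (i₁ : Euc n → M₁) (i₂ : Euc n → M₂) (f₁ : M₁ → M) (f₂ : M₂ → M),
    IsDisc i₁ ∧ IsDisc i₂ ∧
    IsLocalDiffeomorphOn (𝓡 n) (𝓡 n) ∞ f₁ {i₁ 0}ᶜ ∧ InjOn f₁ {i₁ 0}ᶜ ∧
    IsLocalDiffeomorphOn (𝓡 n) (𝓡 n) ∞ f₂ {i₂ 0}ᶜ ∧ InjOn f₂ {i₂ 0}ᶜ ∧
    f₁ '' {i₁ 0}ᶜ ∪ f₂ '' {i₂ 0}ᶜ = univ ∧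
    ∀ x₁ ∈ ({i₁ 0}ᶜ : Set M₁), ∀ x₂ ∈ ({i₂ 0}ᶜ : Set M₂), f₁ x₁ = f₂ x₂ ↔ Glued i₁ i₂ x₁ x₂

/-- `M` is diffeomorphic to a connected sum of `M'` with itself: for disjoint embedded discs `i₁`,
`i₂` in `M'`, it is the smooth manifold obtained from `M' ∖ {i₁(0), i₂(0)}` by identifying
`i₁ (t ξ)` with `i₂ ((1 - t) ξ)`. The map `f` is the quotient map. -/
def IsSelfConnectedSum (n : ℕ) (M' M : Type*)
    [TopologicalSpace M'] [ChartedSpace (Euc n) M'] [TopologicalSpace M] [ChartedSpace (Euc n) M] :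
    Prop :=
  ∃ (i₁ i₂ : Euc n → M') (f : M' → M),
    IsDisc i₁ ∧ IsDisc i₂ ∧
    Disjoint (i₁ '' Metric.closedBall 0 1) (i₂ '' Metric.closedBall 0 1) ∧
    IsLocalDiffeomorphOn (𝓡 n) (𝓡 n) ∞ f {i₁ 0, i₂ 0}ᶜ ∧
    f '' {i₁ 0, i₂ 0}ᶜ = univ ∧
    ∀ x ∈ ({i₁ 0, i₂ 0}ᶜ : Set M'), ∀ y ∈ ({i₁ 0, i₂ 0}ᶜ : Set M'),
      f x = f y ↔ x = y ∨ Glued i₁ i₂ x y ∨ Glued i₁ i₂ y x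

end Geometry

end NeckSurgery

end

/-!
Surgery is undone by removing the centres of the two caps and gluing along the caps again. Outside
the core of the neck nothing has changed, and each half of the core, in polar coordinates adapted to
the profile of its cap, is a punctured ball; the outer collar of each ball is the collar along which
the cap was attached, so each cap extends to a full disc. In polar coordinates the core is therefore
the region `i₁ (t ξ) = i₂ ((1 - t) ξ)` of a connected sum. If the surgered manifold is disconnected,
a clopen set missing both discs would split off a component of the original connected manifold, so
each of the two pieces contains exactly one disc.

For the summand `S^n`, the complement of the centre of a disc is `ℝⁿ` by stereographic projection,
and near infinity the disc is the inversion composed with a germ `κ` of a diffeomorphism at the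
origin. The derivative of `κ` at the origin is absorbed by a radial diffeomorphism, and the
remaining germ, which is tangent to the identity, extends to a diffeomorphism of `ℝⁿ`. Hence the
complement of the centre is itself an open ball, matching the disc along its collar, and this ball
fills the hole left by the disc in the other summand.
-/

namespace NeckSurgery

section LocalDiffeomorphisms

open Filter Topology

variable {E F G : Type*} [NormedAddCommGroup E] [NormedSpace ℝ E] [NormedAddCommGroup F]
  [NormedSpace ℝ F] [NormedAddCommGroup G] [NormedSpace ℝ G]
  {H₁ H₂ H₃ : Type*} [TopologicalSpace H₁] [TopologicalSpace H₂] [TopologicalSpace H₃]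
  {I : ModelWithCorners ℝ E H₁} {J : ModelWithCorners ℝ F H₂} {K : ModelWithCorners ℝ G H₃}
  {M N P : Type*} [TopologicalSpace M] [ChartedSpace H₁ M] [TopologicalSpace N]
  [ChartedSpace H₂ N] [TopologicalSpace P] [ChartedSpace H₃ P] {k : WithTop ℕ∞}

theorem isLocalDiffeomorphAt_of_contMDiffOn_symm (e : OpenPartialHomeomorph M N)
    (he : ContMDiffOn I J k e e.source) (he' : ContMDiffOn J I k e.symm e.target) {x : M}
    (hx : x ∈ e.source) : IsLocalDiffeomorphAt I J k e x :=
  PartialDiffeomorph.isLocalDiffeomorphAt I J k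
    { e with contMDiffOn_toFun := he, contMDiffOn_invFun := he' } hx

theorem isLocalDiffeomorphAt_congr {f g : M → N} {x : M} (hf : IsLocalDiffeomorphAt I J k f x)
    (h : g =ᶠ[𝓝 x] f) : IsLocalDiffeomorphAt I J k g x := by
  obtain ⟨Φ, hx, hfΦ⟩ := hf
  obtain ⟨U, hgf, hU, hxU⟩ := mem_nhds_iff.mp h
  exact ⟨{ Φ.toOpenPartialHomeomorph.restrOpen U hU with
      contMDiffOn_toFun := Φ.contMDiffOn_toFun.mono inter_subset_left
      contMDiffOn_invFun := Φ.contMDiffOn_invFun.mono inter_subset_left }, ⟨hx, hxU⟩,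
    fun y hy => (hgf hy.2).trans (hfΦ hy.1)⟩

theorem isLocalDiffeomorphAt_of_comp_right {f : M → N} {g : N → P} {h : M → P} {x : M}
    (hh : IsLocalDiffeomorphAt I K k h x) (hf : IsLocalDiffeomorphAt I J k f x)
    (hgf : g ∘ f =ᶠ[𝓝 x] h) : IsLocalDiffeomorphAt J K k g (f x) := by
  have hx : hf.localInverse (f x) = x := hf.localInverse_left_inv hf.localInverse_mem_target
  have hcomp : IsLocalDiffeomorphAt J K k (h ∘ hf.localInverse) (f x) :=
    hf.localInverse_isLocalDiffeomorphAt.comp K P (by rwa [hx])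
  have hcont : Tendsto hf.localInverse (𝓝 (f x)) (𝓝 x) := by
    simpa only [ContinuousAt, hx] using hf.localInverse_contMDiffAt.continuousAt
  refine isLocalDiffeomorphAt_congr hcomp ?_
  filter_upwards [hcont.eventually hgf, hf.localInverse_eventuallyEq_right] with y hy hy'
  exact (congrArg g hy').symm.trans hy

theorem isLocalDiffeomorphAt_of_comp_left {f : M → N} {g : N → P} {h : M → P} {x : M}
    (hh : IsLocalDiffeomorphAt I K k h x) (hg : IsLocalDiffeomorphAt J K k g (f x))
    (hf : ContinuousAt f x) (hgf : g ∘ f =ᶠ[𝓝 x] h) : IsLocalDiffeomorphAt I J k f x := by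
  have hcomp : IsLocalDiffeomorphAt I J k (hg.localInverse ∘ h) x :=
    hh.comp J N (hgf.self_of_nhds ▸ hg.localInverse_isLocalDiffeomorphAt)
  refine isLocalDiffeomorphAt_congr hcomp ?_
  filter_upwards [hgf, hf.eventually hg.localInverse_eventuallyEq_left] with y hy hy'
  exact hy'.symm.trans (congrArg hg.localInverse hy)

theorem isOpen_image_of_isLocalDiffeomorphOn {f : M → N} {s U : Set M}
    (hf : IsLocalDiffeomorphOn I J k f s) (hU : IsOpen U) (hUs : U ⊆ s) : IsOpen (f '' U) :=
  isOpen_iff_mem_nhds.mpr <| by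
    rintro _ ⟨x, hx, rfl⟩
    rw [← hf.isLocalHomeomorphOn.map_nhds_eq (hUs hx)]
    exact image_mem_map (hU.mem_nhds hx)

theorem isLocalDiffeomorphAt_subtype_val (U : TopologicalSpace.Opens M) (x : U) :
    IsLocalDiffeomorphAt I I ∞ (Subtype.val : U → M) x := by
  let e := U.openPartialHomeomorphSubtypeCoe ⟨x⟩
  refine isLocalDiffeomorphAt_of_contMDiffOn_symm e
    contMDiff_subtype_val.contMDiffOn (fun y hy => ?_) (mem_univ x)
  rw [← ContMDiffWithinAt.subtypeVal_comp_iff]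
  exact contMDiffWithinAt_id.congr (fun z hz => e.right_inv hz) (e.right_inv hy)

theorem isLocalDiffeomorphAt_of_mem_maximalAtlas {e : OpenPartialHomeomorph N H₂}
    (he : e ∈ IsManifold.maximalAtlas J k N) {x : N} (hx : x ∈ e.source) :
    IsLocalDiffeomorphAt J J k e x :=
  isLocalDiffeomorphAt_of_contMDiffOn_symm e (contMDiffOn_of_mem_maximalAtlas he)
    (contMDiffOn_symm_of_mem_maximalAtlas he) hx

theorem isLocalDiffeomorphAt_symm_of_mem_maximalAtlas {e : OpenPartialHomeomorph N H₂}
    (he : e ∈ IsManifold.maximalAtlas J k N) {y : H₂} (hy : y ∈ e.target) :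
    IsLocalDiffeomorphAt J J k e.symm y :=
  isLocalDiffeomorphAt_of_contMDiffOn_symm e.symm (contMDiffOn_symm_of_mem_maximalAtlas he)
    (contMDiffOn_of_mem_maximalAtlas he) hy

theorem isLocalDiffeomorphAt_of_fderiv_bijective [CompleteSpace E] [CompleteSpace F] {f : E → F}
    {U : Set E} (hU : IsOpen U) (hf : ContDiffOn ℝ k f U) (hk : k ≠ 0) {a : E} (ha : a ∈ U)
    (hf' : Function.Bijective (fderiv ℝ f a)) :
    IsLocalDiffeomorphAt 𝓘(ℝ, E) 𝓘(ℝ, F) k f a := by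
  have hfU : ∀ y ∈ U, ContDiffAt ℝ k f y := fun y hy => hf.contDiffAt (hU.mem_nhds hy)
  let V := {y ∈ U | fderiv ℝ f y ∈ range ((↑) : (E ≃L[ℝ] F) → E →L[ℝ] F)}
  have hV : IsOpen V := (hf.continuousOn_fderiv_of_isOpen hU
    (ENat.one_le_iff_ne_zero_withTop.mpr hk)).isOpen_inter_preimage hU ContinuousLinearEquiv.isOpen
  let f' : E ≃L[ℝ] F := ContinuousLinearEquiv.ofBijective (fderiv ℝ f a)
    (LinearMap.ker_eq_bot.mpr hf'.1) (LinearMap.range_eq_top.mpr hf'.2)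
  have hff' : (f' : E →L[ℝ] F) = fderiv ℝ f a := ContinuousLinearEquiv.coe_ofBijective _ _ _
  have hfa : HasFDerivAt f (f' : E →L[ℝ] F) a :=
    hff' ▸ ((hfU a ha).differentiableAt hk).hasFDerivAt
  let e := ((hfU a ha).toOpenPartialHomeomorph f hfa hk).restrOpen V hV
  refine isLocalDiffeomorphAt_of_contMDiffOn_symm e
    (hf.mono fun y hy => hy.2.1).contMDiffOn (ContDiffOn.contMDiffOn fun y hy => ?_)
    ⟨(hfU a ha).mem_toOpenPartialHomeomorph_source hfa hk, ha, f', hff'⟩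
  obtain ⟨-, hyU, L, hL⟩ := e.map_target hy
  exact (e.contDiffAt_symm hy (hL ▸ ((hfU _ hyU).differentiableAt hk).hasFDerivAt)
    (hfU _ hyU)).contDiffWithinAt

theorem isLocalDiffeomorphAt_of_mfderiv_bijective [CompleteSpace E] [CompleteSpace F]
    {M : Type*} [TopologicalSpace M] [ChartedSpace F M] [IsManifold 𝓘(ℝ, F) k M] {f : E → M}
    {U : Set E} (hU : IsOpen U) (hf : ContMDiffOn 𝓘(ℝ, E) 𝓘(ℝ, F) k f U) (hk : k ≠ 0) {a : E}
    (ha : a ∈ U) (hf' : Function.Bijective (mfderiv 𝓘(ℝ, E) 𝓘(ℝ, F) f a)) :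
    IsLocalDiffeomorphAt 𝓘(ℝ, E) 𝓘(ℝ, F) k f a := by
  have hfa : ContMDiffAt 𝓘(ℝ, E) 𝓘(ℝ, F) k f a := hf.contMDiffAt (hU.mem_nhds ha)
  let φ := chartAt F (f a)
  have hφ : φ ∈ IsManifold.maximalAtlas 𝓘(ℝ, F) k M := IsManifold.chart_mem_maximalAtlas (f a)
  have hφa := isLocalDiffeomorphAt_of_mem_maximalAtlas hφ (mem_chart_source F (f a))
  have hφf : ContDiffOn ℝ k (φ ∘ f) (U ∩ f ⁻¹' φ.source) := contMDiffOn_iff_contDiffOn.mp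
    ((contMDiffOn_of_mem_maximalAtlas hφ).comp (hf.mono inter_subset_left) inter_subset_right)
  have hchain : fderiv ℝ (φ ∘ f) a =
      (mfderiv 𝓘(ℝ, F) 𝓘(ℝ, F) φ (f a)).comp (mfderiv 𝓘(ℝ, E) 𝓘(ℝ, F) f a) := by
    rw [← mfderiv_eq_fderiv]
    exact mfderiv_comp a (hφa.mdifferentiableAt hk) (hfa.mdifferentiableAt hk)
  refine isLocalDiffeomorphAt_of_comp_left (isLocalDiffeomorphAt_of_fderiv_bijective
    (hf.continuousOn.isOpen_inter_preimage hU φ.open_source) hφf hk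
    ⟨ha, mem_chart_source F (f a)⟩ ?_) hφa hfa.continuousAt EventuallyEq.rfl
  rw [hchain]
  exact (hφa.mfderivToContinuousLinearEquiv hk).bijective.comp hf'

end LocalDiffeomorphisms

section SmoothInterpolation

open Filter Topology

/-- A smooth nondecreasing function which is `0` up to `a` and `1` from `b` on (for `a < b`). It
glues functions smoothly in `interpolate`. -/
noncomputable def smoothStep (a b t : ℝ) : ℝ := Real.smoothTransition ((t - a) / (b - a))

variable {a b t : ℝ} {f g : ℝ → ℝ}

theorem contDiff_smoothStep : ContDiff ℝ ∞ (smoothStep a b) :=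
  Real.smoothTransition.contDiff.comp ((contDiff_id.sub contDiff_const).div_const _)

theorem smoothStep_of_le (hab : a < b) (ht : t ≤ a) : smoothStep a b t = 0 :=
  Real.smoothTransition.zero_of_nonpos
    (div_nonpos_of_nonpos_of_nonneg (sub_nonpos.mpr ht) (sub_pos.mpr hab).le)

theorem smoothStep_of_ge (hab : a < b) (ht : b ≤ t) : smoothStep a b t = 1 :=
  Real.smoothTransition.one_of_one_le ((one_le_div (sub_pos.mpr hab)).mpr (sub_le_sub_right ht a))

theorem smoothStep_mem_Icc : smoothStep a b t ∈ Icc 0 1 :=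
  ⟨Real.smoothTransition.nonneg _, Real.smoothTransition.le_one _⟩

theorem monotone_smoothStep (hab : a < b) : Monotone (smoothStep a b) := fun _ _ hst =>
  Real.smoothTransition.monotone
    (div_le_div_of_nonneg_right (sub_le_sub_right hst a) (sub_pos.mpr hab).le)

theorem deriv_smoothStep_eq_zero (hab : a < b) (ht : t ∉ Ioo a b) :
    deriv (smoothStep a b) t = 0 := by
  rcases le_or_gt t a with hta | hta
  · refine IsLocalMin.deriv_eq_zero (Eventually.of_forall fun s => ?_)
    rw [smoothStep_of_le hab hta]
    exact smoothStep_mem_Icc.1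
  · refine IsLocalMax.deriv_eq_zero (Eventually.of_forall fun s => ?_)
    rw [smoothStep_of_ge hab (not_lt.mp fun htb => ht ⟨hta, htb⟩)]
    exact smoothStep_mem_Icc.2

/-- The smooth interpolation between `f`, with which it agrees up to `a`, and `g`, with which it
agrees from `b` on (for `a < b`). -/
noncomputable def interpolate (a b : ℝ) (f g : ℝ → ℝ) (t : ℝ) : ℝ :=
  (1 - smoothStep a b t) * f t + smoothStep a b t * g t

theorem interpolate_of_le (hab : a < b) (ht : t ≤ a) : interpolate a b f g t = f t := by
  simp [interpolate, smoothStep_of_le hab ht]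

theorem interpolate_of_ge (hab : a < b) (ht : b ≤ t) : interpolate a b f g t = g t := by
  simp [interpolate, smoothStep_of_ge hab ht]

theorem interpolate_mem {s : Set ℝ} (hs : Convex ℝ s) (hf : f t ∈ s) (hg : g t ∈ s) :
    interpolate a b f g t ∈ s :=
  hs hf hg (sub_nonneg.mpr smoothStep_mem_Icc.2) smoothStep_mem_Icc.1 (sub_add_cancel 1 _)

theorem contDiffOn_interpolate {s : Set ℝ} (hf : ContDiffOn ℝ ∞ f s) (hg : ContDiffOn ℝ ∞ g s) :
    ContDiffOn ℝ ∞ (interpolate a b f g) s :=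
  ((contDiff_const.sub contDiff_smoothStep).contDiffOn.mul hf).add
    (contDiff_smoothStep.contDiffOn.mul hg)

theorem deriv_interpolate_pos (hab : a < b) (hf : DifferentiableAt ℝ f t)
    (hg : DifferentiableAt ℝ g t) (hf' : 0 < deriv f t) (hg' : 0 < deriv g t)
    (hfg : t ∈ Ioo a b → f t ≤ g t) : 0 < deriv (interpolate a b f g) t := by
  have hχ : HasDerivAt (smoothStep a b) (deriv (smoothStep a b) t) t :=
    (contDiff_smoothStep.differentiable (by simp) t).hasDerivAt
  have hderiv : deriv (interpolate a b f g) t =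
      interpolate a b (deriv f) (deriv g) t + deriv (smoothStep a b) t * (g t - f t) := by
    have h := ((hχ.const_sub 1).mul hf.hasDerivAt).add (hχ.mul hg.hasDerivAt)
    refine h.deriv.trans ?_
    rw [interpolate]
    ring
  have hstep : 0 ≤ deriv (smoothStep a b) t * (g t - f t) := by
    by_cases ht : t ∈ Ioo a b
    · exact mul_nonneg (monotone_smoothStep hab).deriv_nonneg (sub_nonneg.mpr (hfg ht))
    · rw [deriv_smoothStep_eq_zero hab ht, zero_mul]
  rw [hderiv]
  exact add_pos_of_pos_of_nonneg (interpolate_mem (convex_Ioi 0) hf' hg') hstep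

end SmoothInterpolation

section AxialProfile

/-- The axial coordinate along one half of the neck as a function of the radius in the disc which
caps it: affine on the unit ball, so that `t` and `1 - t` give opposite values there, equal to `3Λ`
at radius `2`, and below the end `4Λ` of the neck. -/
structure IsAxialProfile (Λ : ℝ) (P : ℝ → ℝ) : Prop where
  smooth : ContDiffOn ℝ ∞ P (Ioi 0)
  deriv_pos : ∀ t > 0, 0 < deriv P t
  eq_affine : ∀ t ≤ 1, P t = Λ * (t - 1 / 2)
  apply_two : P 2 = 3 * Λ
  lt : ∀ t > 0, P t < 4 * Λ

variable {Λ t : ℝ} {P θ : ℝ → ℝ}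

namespace IsAxialProfile

theorem pos (hP : IsAxialProfile Λ P) : 0 < Λ := by
  have h := hP.lt 2 two_pos
  rw [hP.apply_two] at h
  linarith

theorem strictMonoOn (hP : IsAxialProfile Λ P) : StrictMonoOn P (Ioi 0) :=
  strictMonoOn_of_deriv_pos (convex_Ioi 0) hP.smooth.continuousOn
    fun t ht => hP.deriv_pos t (interior_subset ht)

theorem neg_half_lt (hP : IsAxialProfile Λ P) (ht : 0 < t) : -(Λ / 2) < P t := by
  have hmin : 0 < min t 1 := lt_min ht one_pos
  calc -(Λ / 2) < Λ * (min t 1 - 1 / 2) := by nlinarith [mul_pos hP.pos hmin]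
    _ = P (min t 1) := (hP.eq_affine _ (min_le_right _ _)).symm
    _ ≤ P t := hP.strictMonoOn.monotoneOn hmin ht (min_le_left _ _)

theorem abs_lt (hP : IsAxialProfile Λ P) (ht : 0 < t) : |P t| < 4 * Λ :=
  _root_.abs_lt.mpr ⟨by linarith [hP.neg_half_lt ht, hP.pos], hP.lt t ht⟩

theorem abs_le_iff (hP : IsAxialProfile Λ P) (ht : 0 < t) : |P t| ≤ 3 * Λ ↔ t ≤ 2 := by
  rw [← hP.strictMonoOn.le_iff_le ht (mem_Ioi.mpr two_pos), hP.apply_two, abs_le,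
    and_iff_right (by linarith [hP.neg_half_lt ht, hP.pos])]

theorem lt_half_iff (hP : IsAxialProfile Λ P) (ht : 0 < t) : P t < Λ / 2 ↔ t < 1 := by
  rw [← hP.strictMonoOn.lt_iff_lt ht (mem_Ioi.mpr one_pos), hP.eq_affine 1 le_rfl]
  norm_num [div_eq_mul_inv]

theorem exists_eq (hP : IsAxialProfile Λ P) {z : ℝ} (hz : z ∈ Icc 0 (3 * Λ)) :
    ∃ t ∈ Ioc 0 2, P t = z := by
  have hcont : ContinuousOn P (Icc (1 / 2) 2) :=
    hP.smooth.continuousOn.mono fun t ht => lt_of_lt_of_le one_half_pos ht.1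
  obtain ⟨t, ht, rfl⟩ := intermediate_value_Icc (by norm_num) hcont
    (show z ∈ Icc (P (1 / 2)) (P 2) by
      rwa [hP.apply_two, hP.eq_affine _ one_half_lt_one.le, sub_self, mul_zero])
  exact ⟨t, ⟨lt_of_lt_of_le one_half_pos ht.1, ht.2⟩, rfl⟩

end IsAxialProfile

theorem exists_isAxialProfile (hΛ : 0 < Λ) (hθ : ContDiffOn ℝ ∞ θ (Ioi 0))
    (hθ' : ∀ t > 0, deriv θ t < 0) (hθ_pos : ∀ t > 0, 0 < θ t) (hθ_two : θ 2 = Λ) :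
    ∃ P, IsAxialProfile Λ P ∧ ∀ t ≥ 2, P t = 4 * Λ - θ t := by
  have hanti : StrictAntiOn θ (Ioi 0) := strictAntiOn_of_deriv_neg (convex_Ioi 0)
    hθ.continuousOn fun t ht => hθ' t (interior_subset ht)
  have hdiff : ∀ t > 0, DifferentiableAt ℝ θ t := fun t ht =>
    (hθ.contDiffAt (Ioi_mem_nhds ht)).differentiableAt (by simp)
  obtain ⟨a, ⟨ha1, ha2⟩, hθa⟩ : ∃ a ∈ Ioo (1 : ℝ) 2, θ a < 2 * Λ := by
    have hlt : ∀ᶠ t in nhdsWithin 2 (Iio 2), θ t < 2 * Λ :=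
      ((hdiff 2 two_pos).continuousAt.eventually_lt_const (by linarith)).filter_mono
        nhdsWithin_le_nhds
    exact (Filter.Eventually.and (Ioo_mem_nhdsLT one_lt_two) hlt).exists
  refine ⟨interpolate a 2 (fun t => Λ * (t - 1 / 2)) (fun t => 4 * Λ - θ t),
    ⟨contDiffOn_interpolate (by fun_prop) (contDiffOn_const.sub hθ), fun t ht => ?_,
      fun t ht => interpolate_of_le ha2 (ht.trans ha1.le), ?_, fun t ht => ?_⟩,
    fun t ht => interpolate_of_ge ha2 ht⟩
  · have hlinear : HasDerivAt (fun t => Λ * (t - 1 / 2)) Λ t := by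
      simpa only [id_eq, mul_one] using ((hasDerivAt_id t).sub_const (1 / 2)).const_mul Λ
    have hcap : HasDerivAt (fun t => 4 * Λ - θ t) (-deriv θ t) t :=
      (hdiff t ht).hasDerivAt.const_sub _
    refine deriv_interpolate_pos ha2 hlinear.differentiableAt hcap.differentiableAt
      (hlinear.deriv.symm ▸ hΛ) (hcap.deriv.symm ▸ neg_pos.mpr (hθ' t ht)) fun hta => ?_
    have := hanti (one_pos.trans ha1) ht hta.1
    nlinarith [hta.2]
  · rw [interpolate_of_ge ha2 le_rfl, hθ_two]
    ring
  · have hcap : 4 * Λ - θ t < 4 * Λ := sub_lt_self _ (hθ_pos t ht)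
    rcases le_total t 2 with ht2 | ht2
    · exact interpolate_mem (convex_Iio (4 * Λ))
        (show Λ * (t - 1 / 2) < 4 * Λ by nlinarith) hcap
    · rwa [interpolate_of_ge ha2 ht2]

end AxialProfile

section CollarDiscs

open OpenPartialHomeomorph (univUnitBall)

/-- The radial function of `x ↦ univUnitBall (r • x)`, the diffeomorphism from `ℝⁿ` to its unit
ball by which the caps are reparametrised. -/
noncomputable def capRadius (r t : ℝ) : ℝ := Real.sin (Real.arctan (r * t))

theorem univUnitBall_smul_smul {E : Type*} [NormedAddCommGroup E] [NormedSpace ℝ E] (r t : ℝ)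
    {ξ : E} (hξ : ‖ξ‖ = 1) : univUnitBall (r • t • ξ) = capRadius r t • ξ := by
  rw [smul_smul, OpenPartialHomeomorph.univUnitBall_apply, norm_smul, hξ, mul_one,
    Real.norm_eq_abs, sq_abs, smul_smul, inv_mul_eq_div, capRadius, Real.sin_arctan]

theorem contDiff_capRadius {r : ℝ} : ContDiff ℝ ∞ (capRadius r) :=
  Real.contDiff_sin.comp (Real.contDiff_arctan.comp (contDiff_const.mul contDiff_id))

theorem deriv_capRadius_pos {r : ℝ} (hr : 0 < r) (t : ℝ) : 0 < deriv (capRadius r) t := by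
  have h : HasDerivAt (capRadius r) (Real.cos (Real.arctan (r * t)) *
      (1 / (1 + (r * t) ^ 2) * (r * 1))) t :=
    (((hasDerivAt_id t).const_mul r).arctan).sin
  rw [h.deriv]
  have := Real.cos_arctan_pos (r * t)
  positivity

theorem capRadius_image_Ioi {r : ℝ} (hr : 0 < r) : capRadius r '' Ioi 0 = Ioo 0 1 := by
  ext s
  constructor
  · rintro ⟨t, ht, rfl⟩
    refine ⟨Real.sin_arctan_pos.mpr (mul_pos hr ht), ?_⟩
    rw [capRadius, ← Real.sin_pi_div_two]
    exact Real.sin_lt_sin_of_lt_of_le_pi_div_two (Real.neg_pi_div_two_lt_arctan _).le le_rfl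
      (Real.arctan_lt_pi_div_two _)
  · rintro ⟨hs0, hs1⟩
    have hs : 0 < Real.arcsin s := Real.arcsin_pos.mpr hs0
    have hs' : Real.arcsin s < Real.pi / 2 := Real.arcsin_lt_pi_div_two.mpr hs1
    refine ⟨Real.tan (Real.arcsin s) / r, div_pos (Real.tan_pos_of_pos_of_lt_pi_div_two hs hs') hr,
      ?_⟩
    rw [capRadius, mul_div_cancel₀ _ hr.ne', Real.arctan_tan (by linarith) hs',
      Real.sin_arcsin (by linarith) hs1.le]

theorem exists_comp_capRadius {θ : ℝ → ℝ} {Λ z₁ : ℝ} (hθ : ContDiffOn ℝ ∞ θ (Ioo 0 1))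
    (hθ' : ∀ t ∈ Ioo 0 1, deriv θ t < 0) (himage : θ '' Ioo 0 1 = Ioo 0 z₁) (hΛ : Λ ∈ Ioo 0 z₁) :
    ∃ r > 0, ContDiffOn ℝ ∞ (θ ∘ capRadius r) (Ioi 0) ∧
      (∀ t > 0, deriv (θ ∘ capRadius r) t < 0) ∧
      (θ ∘ capRadius r) '' Ioi 0 = Ioo 0 z₁ ∧ (θ ∘ capRadius r) 2 = Λ := by
  rw [← himage, ← capRadius_image_Ioi one_pos] at hΛ
  obtain ⟨_, ⟨t₀, ht₀, rfl⟩, rfl⟩ := hΛ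
  have hr : 0 < t₀ / 2 := half_pos ht₀
  have hmaps : MapsTo (capRadius (t₀ / 2)) (Ioi 0) (Ioo 0 1) := mapsTo_iff_image_subset.mpr
    (capRadius_image_Ioi hr).subset
  refine ⟨t₀ / 2, hr, hθ.comp contDiff_capRadius.contDiffOn hmaps, fun t ht => ?_, ?_, ?_⟩
  · have hθt : DifferentiableAt ℝ θ (capRadius (t₀ / 2) t) :=
      (hθ.contDiffAt (isOpen_Ioo.mem_nhds (hmaps ht))).differentiableAt (by simp)
    rw [deriv_comp t hθt (contDiff_capRadius.differentiable (by simp) t)]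
    exact mul_neg_of_neg_of_pos (hθ' _ (hmaps ht)) (deriv_capRadius_pos hr t)
  · rw [image_comp, capRadius_image_Ioi hr, himage]
  · simp [capRadius]

variable {n d : ℕ} {M M' : Type*} [TopologicalSpace M'] [ChartedSpace (Euc n) M']

theorem isDisc_comp_univUnitBall_smul {c : Euc n → M'}
    (hc : IsLocalDiffeomorphOn (𝓡 n) (𝓡 n) ∞ c (Metric.ball 0 1)) (hc' : InjOn c (Metric.ball 0 1))
    {r : ℝ} (hr : r ≠ 0) : IsDisc fun x => c (univUnitBall (r • x)) := by
  have hmem (x : Euc n) : univUnitBall x ∈ Metric.ball (0 : Euc n) 1 :=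
    univUnitBall.map_source (mem_univ x)
  refine ⟨fun x => ?_, fun x y hxy => ?_⟩
  · have hsmul : IsLocalDiffeomorphAt (𝓡 n) (𝓡 n) ∞ (fun x : Euc n => r • x) x :=
      (ContinuousLinearEquiv.smulLeft (M₁ := Euc n)
        (Units.mk0 r hr)).toDiffeomorph.isLocalDiffeomorph x
    have hball : IsLocalDiffeomorphAt (𝓡 n) (𝓡 n) ∞ (univUnitBall (E := Euc n)) (r • x) :=
      isLocalDiffeomorphAt_of_contMDiffOn_symm _
        OpenPartialHomeomorph.contDiff_univUnitBall.contDiffOn.contMDiffOn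
        OpenPartialHomeomorph.contDiffOn_univUnitBall_symm.contMDiffOn (mem_univ _)
    exact (hsmul.comp _ _ hball).comp _ _ (hc ⟨_, hmem _⟩)
  · exact smul_right_injective _ hr
      (univUnitBall.injOn (mem_univ _) (mem_univ _) (hc' (hmem _) (hmem _) hxy))

theorem range_comp_univUnitBall_smul {X : Type*} (c : Euc n → X) {r : ℝ} (hr : r ≠ 0) :
    range (fun x => c (univUnitBall (r • x))) = c '' Metric.ball 0 1 := by
  have hsmul : Function.Surjective fun x : Euc n => r • x := (MulAction.bijective₀ hr).2
  have hball : range (univUnitBall (E := Euc n)) = Metric.ball 0 1 := by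
    rw [← image_univ]
    exact univUnitBall.image_source_eq_target
  rw [← hball, ← range_comp]
  exact hsmul.range_comp (c ∘ univUnitBall)

/-- The neck `N` in polar coordinates of the punctured `ℝⁿ`: the point `v` is sent to the point of
the neck with the direction of `v` and with axial coordinate `g ‖v‖`. -/
noncomputable def polarNeck (N : Euc n → ℝ → M) (g : ℝ → ℝ) (v : Euc n) : M :=
  N (‖v‖⁻¹ • v) (g ‖v‖)

theorem polarNeck_smul (N : Euc n → ℝ → M) (g : ℝ → ℝ) {ξ : Euc n} (hξ : ‖ξ‖ = 1) {t : ℝ}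
    (ht : 0 < t) : polarNeck N g (t • ξ) = N ξ (g t) := by
  rw [polarNeck, norm_smul, hξ, mul_one, Real.norm_of_nonneg ht.le, inv_smul_smul₀ ht.ne']

/-- The disc `i` consists of a cap and of the collar `2 < ‖v‖`, on which it is the unchanged part
`j : M ∖ core → M'` in the polar coordinates of the neck. The sign `σ` tells to which half of the
neck the collar belongs. -/
structure IsCollarDisc (N : Euc n → ℝ → M) (Λ σ : ℝ) (j : M → M') (i : Euc n → M') (P : ℝ → ℝ) :
    Prop where
  isDisc : IsDisc i
  profile : IsAxialProfile Λ P
  collar : ∀ v, 2 < ‖v‖ → i v = j (polarNeck N (σ • P) v)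
  of_eq : ∀ x ∉ core N Λ, ∀ v, j x = i v → 2 < ‖v‖ ∧ x = polarNeck N (σ • P) v

theorem IsAttachedCap.exists_isCollarDisc {F : M → Euc d} {N : Euc n → ℝ → M} {Λ τ B : ℝ}
    {φ : ℝ → ℝ} {Q : Euc n →ₗᵢ[ℝ] Euc d} {F' : M' → Euc d} {j : M → M'} {s : ℝ} {c : Euc n → M'}
    (hΛ : 0 < Λ) (h : IsAttachedCap F N Λ τ B φ Q F' j s c) :
    ∃ i P, IsCollarDisc N Λ (-s) j i P ∧ range i = c '' Metric.ball 0 1 := by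
  obtain ⟨_, θ, z₁, hcap, hθ, hθ', himage, hc, hc', -, hcollar, hmem⟩ := h
  have hΛz : Λ < z₁ := by linarith [hcap.mem.1]
  obtain ⟨r, hr, hη, hη', hη_image, hη_two⟩ := exists_comp_capRadius hθ hθ' himage ⟨hΛ, hΛz⟩
  have hanti : StrictAntiOn (θ ∘ capRadius r) (Ioi 0) := strictAntiOn_of_deriv_neg (convex_Ioi 0)
    hη.continuousOn fun t ht => hη' t (interior_subset ht)
  obtain ⟨P, hP, hP_eq⟩ := exists_isAxialProfile hΛ hη hη'
    (fun t ht => (hη_image.subset (mem_image_of_mem _ ht)).1) hη_two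
  have hdisc := isDisc_comp_univUnitBall_smul hc hc' hr.ne'
  have hrange := range_comp_univUnitBall_smul c hr.ne'
  have hpolar : ∀ ξ : Euc n, ‖ξ‖ = 1 → ∀ t : ℝ, 2 < t →
      polarNeck N (-s • P) (t • ξ) = N ξ (s * (θ (capRadius r t) - 4 * Λ)) := by
    intro ξ hξ t ht
    rw [polarNeck_smul _ _ hξ (two_pos.trans ht), Pi.smul_apply, hP_eq t ht.le, smul_eq_mul,
      neg_mul_comm, neg_sub, Function.comp_apply]
  have hcollar' : ∀ ξ : Euc n, ‖ξ‖ = 1 → ∀ t : ℝ, 2 < t →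
      c (univUnitBall (r • t • ξ)) = j (polarNeck N (-s • P) (t • ξ)) := by
    intro ξ hξ t ht
    have ht0 : t ∈ Ioi 0 := two_pos.trans ht
    rw [hpolar ξ hξ t ht, univUnitBall_smul_smul _ _ hξ]
    exact hcollar ξ hξ _ ((capRadius_image_Ioi hr).subset (mem_image_of_mem _ ht0))
      ((hanti (mem_Ioi.mpr two_pos) ht0 ht).trans_eq hη_two)
  refine ⟨_, P, ⟨hdisc, hP, fun v hv => ?_, fun x hx v hxv => ?_⟩, hrange⟩
  · have hv0 : ‖v‖ ≠ 0 := (two_pos.trans hv).ne'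
    have h := hcollar' (‖v‖⁻¹ • v) (norm_smul_inv_norm (norm_ne_zero_iff.mp hv0)) ‖v‖ hv
    rwa [smul_inv_smul₀ hv0] at h
  · obtain ⟨ξ, hξ, ζ, hζ, rfl⟩ := hmem x hx (hrange ▸ ⟨v, hxv.symm⟩)
    obtain ⟨t, ht0, rfl⟩ := hη_image.superset ⟨hζ.1, hζ.2.trans hΛz⟩
    have ht : 2 < t := (hanti.lt_iff_gt ht0 (mem_Ioi.mpr two_pos)).mp (hζ.2.trans_eq hη_two.symm)
    have hv : v = t • ξ := by
      refine hdisc.2 (hxv.symm.trans ?_)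
      rw [Function.comp_apply, ← hpolar ξ hξ t ht]
      exact (hcollar' ξ hξ t ht).symm
    have hnorm : ‖v‖ = t := by rw [hv, norm_smul, hξ, mul_one, Real.norm_of_nonneg ht0.le]
    exact ⟨hnorm ▸ ht, hv ▸ (hpolar ξ hξ t ht).symm⟩

end CollarDiscs

section PolarNeck

open Filter Topology

theorem mfderiv_apply_eq_zero_of_eventually_const {E F H M : Type*} [NormedAddCommGroup E]
    [NormedSpace ℝ E] [NormedAddCommGroup F] [NormedSpace ℝ F] [TopologicalSpace H]
    {I : ModelWithCorners ℝ F H} [TopologicalSpace M] [ChartedSpace H M] {f : E → M} {p v : E}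
    (hf : MDifferentiableAt 𝓘(ℝ, E) I f p) (hconst : ∀ᶠ t in 𝓝 (0 : ℝ), f (p + t • v) = f p) :
    mfderiv 𝓘(ℝ, E) I f p v = (0 : F) := by
  have hline : HasDerivAt (fun t : ℝ => p + t • v) v 0 := by
    simpa only [id_eq, one_smul] using ((hasDerivAt_id (0 : ℝ)).smul_const v).const_add p
  have hp : p + (0 : ℝ) • v = p := by simp
  rw [← hp] at hf
  have hchain := hf.hasMFDerivAt.comp (0 : ℝ) hline.hasFDerivAt.hasMFDerivAt
  have hzero : mfderiv 𝓘(ℝ, ℝ) I (f ∘ fun t : ℝ => p + t • v) 0 = 0 :=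
    (EventuallyEq.mfderiv_eq hconst).trans mfderiv_const
  have happly : (mfderiv 𝓘(ℝ, E) I f (p + (0 : ℝ) • v)) ((1 : ℝ) • v) = (0 : F) :=
    congrArg (fun L => L (1 : ℝ)) (hchain.mfderiv.symm.trans hzero)
  rwa [hp, one_smul] at happly

variable {n : ℕ}

/-- The map `(x, z) ↦ pt x z` as a continuous linear equivalence. -/
noncomputable def ptEquiv (n : ℕ) : (Euc n × ℝ) ≃L[ℝ] Cyl n :=
  (WithLp.prodContinuousLinearEquiv 2 ℝ (Euc n) ℝ).symm

theorem pt_add_smul (x y : Euc n) (z w r : ℝ) :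
    pt (x + r • y) (z + r * w) = pt x z + r • pt y w := rfl

theorem isOpen_tube {I : Set ℝ} (hI : IsOpen I) : IsOpen (tube n I) :=
  (isOpen_ne.preimage (continuous_fst.comp (ptEquiv n).symm.continuous)).inter
    (hI.preimage (continuous_snd.comp (ptEquiv n).symm.continuous))

theorem surjective_comp_graph {T : Cyl n →L[ℝ] Euc n} (hT : Function.Surjective T) {x : Euc n}
    (hTx : T (pt x 0) = 0) {ℓ : Euc n →L[ℝ] ℝ} (hℓ : ℓ x ≠ 0) :
    Function.Surjective fun v => T (pt v (ℓ v)) := by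
  intro y
  obtain ⟨w, rfl⟩ := hT y
  let r := (w.snd - ℓ w.fst) / ℓ x
  have hr : ℓ (w.fst + r • x) = w.snd + r * 0 := by
    rw [map_add, map_smul, smul_eq_mul, div_mul_cancel₀ _ hℓ]
    ring
  refine ⟨w.fst + r • x, ?_⟩
  simp only [hr, pt_add_smul, map_add, map_smul, hTx, smul_zero, add_zero]
  rfl

theorem radialExt_smul {β : Type*} (f : Euc n → ℝ → β) {r : ℝ} (hr : 0 < r) (x : Euc n) (z : ℝ) :
    radialExt f (pt (r • x) z) = radialExt f (pt x z) := by
  change f (‖r • x‖⁻¹ • r • x) z = f (‖x‖⁻¹ • x) z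
  rw [norm_smul, Real.norm_of_nonneg hr.le, smul_smul, mul_inv, mul_right_comm,
    inv_mul_cancel₀ hr.ne', one_mul]

/-- The lift of a punctured `ℝⁿ` to `(ℝⁿ ∖ 0) × ℝ` along which `radialExt N` is
`polarNeck N g`. -/
noncomputable def polarLift (g : ℝ → ℝ) (v : Euc n) : Cyl n := pt v (g ‖v‖)

theorem contDiffOn_polarLift {g : ℝ → ℝ} (hg : ContDiffOn ℝ ∞ g (Ioi 0)) :
    ContDiffOn ℝ ∞ (polarLift g) ({0}ᶜ : Set (Euc n)) := by
  have hnorm : ContDiffOn ℝ ∞ (fun v : Euc n => ‖v‖) {0}ᶜ := fun v hv =>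
    (contDiffAt_norm ℝ hv).contDiffWithinAt
  exact (ptEquiv n).contDiff.comp_contDiffOn
    (contDiffOn_id.prodMk (hg.comp hnorm fun v hv => norm_pos_iff.mpr hv))

theorem hasFDerivAt_polarLift {g : ℝ → ℝ} {x : Euc n} (hx : x ≠ 0)
    (hg : DifferentiableAt ℝ g ‖x‖) :
    HasFDerivAt (polarLift g) ((ptEquiv n : (Euc n × ℝ) →L[ℝ] Cyl n).comp
      ((ContinuousLinearMap.id ℝ (Euc n)).prod (deriv g ‖x‖ • fderiv ℝ (‖·‖) x))) x := by
  have hnorm : HasFDerivAt (fun v : Euc n => ‖v‖) (fderiv ℝ (‖·‖) x) x :=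
    ((contDiffAt_norm (n := 1) ℝ hx).differentiableAt (by simp)).hasFDerivAt
  exact (ptEquiv n).hasFDerivAt.comp x
    ((hasFDerivAt_id x).prodMk (hg.hasDerivAt.comp_hasFDerivAt x hnorm))

variable {M : Type*} [TopologicalSpace M] [ChartedSpace (Euc n) M] {N : Euc n → ℝ → M}

theorem mfderiv_radialExt_radial {x : Euc n} {z : ℝ}
    (hN : MDifferentiableAt 𝓘(ℝ, Cyl n) (𝓡 n) (radialExt N) (pt x z)) :
    mfderiv 𝓘(ℝ, Cyl n) (𝓡 n) (radialExt N) (pt x z) (pt x 0) = (0 : Euc n) := by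
  refine mfderiv_apply_eq_zero_of_eventually_const hN ?_
  filter_upwards [Ioi_mem_nhds neg_one_lt_zero] with t ht
  have h : pt x z + t • pt x 0 = pt ((1 + t) • x) z := by
    rw [← pt_add_smul, add_smul, one_smul, mul_zero, add_zero]
  rw [h, radialExt_smul N (by linarith [mem_Ioi.mp ht])]

theorem isLocalDiffeomorphAt_polarNeck [IsManifold (𝓡 n) ∞ M] {a b : ℝ}
    (hN : IsTopologicalNeck N a b) {g : ℝ → ℝ} (hg : ContDiffOn ℝ ∞ g (Ioi 0))
    (hg' : ∀ t > 0, deriv g t ≠ 0) (hg_mem : ∀ t > 0, g t ∈ Ioo a b) {x : Euc n} (hx : x ≠ 0) :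
    IsLocalDiffeomorphAt (𝓡 n) (𝓡 n) ∞ (polarNeck N g) x := by
  have hsub : tube n (Ioo a b) ⊆ tube n (Icc a b) := fun p hp => ⟨hp.1, Ioo_subset_Icc_self hp.2⟩
  have hmaps : MapsTo (polarLift g) ({0}ᶜ : Set (Euc n)) (tube n (Ioo a b)) := fun v hv =>
    ⟨hv, hg_mem _ (norm_pos_iff.mpr hv)⟩
  have hsmooth : ContMDiffOn 𝓘(ℝ, Cyl n) (𝓡 n) ∞ (radialExt N) (tube n (Ioo a b)) :=
    hN.smooth.mono hsub
  have hnhds : tube n (Ioo a b) ∈ 𝓝 (polarLift g x) := (isOpen_tube isOpen_Ioo).mem_nhds (hmaps hx)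
  have hdiff : MDifferentiableAt 𝓘(ℝ, Cyl n) (𝓡 n) (radialExt N) (polarLift g x) :=
    (hsmooth.contMDiffAt hnhds).mdifferentiableAt (by simp)
  have hx' : 0 < ‖x‖ := norm_pos_iff.mpr hx
  have hlift := hasFDerivAt_polarLift hx
    ((hg.contDiffAt (Ioi_mem_nhds hx')).differentiableAt (by simp))
  have hnorm : fderiv ℝ (fun v : Euc n => ‖v‖) x x = ‖x‖ :=
    ((contDiffAt_norm (n := 1) ℝ hx).differentiableAt (by simp)).fderiv_norm_self
  have hN' : Function.Surjective
      (mfderiv 𝓘(ℝ, Cyl n) (𝓡 n) (radialExt N) (polarLift g x)) := by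
    have h := hN.submersive _ (hsub (hmaps hx))
    rwa [mfderivWithin_of_mem_nhds (mem_of_superset hnhds hsub)] at h
  have hslope : (deriv g ‖x‖ • fderiv ℝ (fun v : Euc n => ‖v‖) x) x ≠ 0 := by
    rw [smul_apply, hnorm, smul_eq_mul]
    exact mul_ne_zero (hg' _ hx') hx'.ne'
  have hsurj : Function.Surjective (mfderiv (𝓡 n) (𝓡 n) (radialExt N ∘ polarLift g) x) := by
    rw [(hdiff.hasMFDerivAt.comp x hlift.hasMFDerivAt).mfderiv]
    exact surjective_comp_graph hN' (mfderiv_radialExt_radial hdiff) hslope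
  have hinj (T : Euc n →L[ℝ] Euc n) (hT : Function.Surjective T) : Function.Injective T :=
    (LinearMap.injective_iff_surjective (f := T.toLinearMap)).mpr hT
  exact isLocalDiffeomorphAt_of_mfderiv_bijective isOpen_compl_singleton
    (hsmooth.comp (contDiffOn_polarLift hg).contMDiffOn hmaps) (by simp) hx
    ⟨hinj _ hsurj, hsurj⟩

theorem isCompact_core {Λ : ℝ} (hN : IsTopologicalNeck N (-(4 * Λ)) (4 * Λ)) :
    IsCompact (core N Λ) := by
  let K : Set (Euc n × ℝ) := Metric.sphere 0 1 ×ˢ Icc (-(3 * Λ)) (3 * Λ)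
  have hK : IsCompact K := (isCompact_sphere 0 1).prod isCompact_Icc
  have hmaps : MapsTo (ptEquiv n) K (tube n (Icc (-(4 * Λ)) (4 * Λ))) := by
    rintro ⟨ξ, z⟩ ⟨hξ, hz₁, hz₂⟩
    replace hz₁ : -(3 * Λ) ≤ z := hz₁
    replace hz₂ : z ≤ 3 * Λ := hz₂
    change ξ ≠ 0 ∧ -(4 * Λ) ≤ z ∧ z ≤ 4 * Λ
    exact ⟨ne_zero_of_mem_unit_sphere ⟨ξ, hξ⟩, by linarith, by linarith⟩
  have hunit (ξ : Euc n) (hξ : ‖ξ‖ = 1) (z : ℝ) : N ξ z = radialExt N (ptEquiv n (ξ, z)) := by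
    change _ = N (‖ξ‖⁻¹ • ξ) z
    rw [hξ, inv_one, one_smul]
  have hcore : core N Λ = (radialExt N ∘ ptEquiv n) '' K := by
    ext x
    constructor
    · rintro ⟨ξ, hξ, z, hz, rfl⟩
      exact ⟨(ξ, z), ⟨mem_sphere_zero_iff_norm.mpr hξ, hz⟩, (hunit ξ hξ z).symm⟩
    · rintro ⟨⟨ξ, z⟩, ⟨hξ, hz⟩, rfl⟩
      exact ⟨ξ, mem_sphere_zero_iff_norm.mp hξ, z, hz,
        (hunit ξ (mem_sphere_zero_iff_norm.mp hξ) z).symm⟩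
  rw [hcore]
  exact hK.image_of_continuousOn
    (hN.smooth.continuousOn.comp (ptEquiv n).continuous.continuousOn hmaps)

end PolarNeck

section Regluing

open Filter Topology

variable {n : ℕ} {M M' : Type*} {N : Euc n → ℝ → M} {Λ σ σ' : ℝ} {P P' : ℝ → ℝ} {v w : Euc n}

namespace IsAxialProfile

theorem smul_mem_Ioo (hP : IsAxialProfile Λ P) (hσ : |σ| = 1) {t : ℝ} (ht : 0 < t) :
    (σ • P) t ∈ Ioo (-(4 * Λ)) (4 * Λ) := by
  rw [mem_Ioo, ← _root_.abs_lt, Pi.smul_apply, smul_eq_mul, abs_mul, hσ, one_mul]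
  exact hP.abs_lt ht

theorem polarNeck_mem_core (hP : IsAxialProfile Λ P) (hσ : |σ| = 1) (hv : v ≠ 0) (hv2 : ‖v‖ ≤ 2) :
    polarNeck N (σ • P) v ∈ core N Λ := by
  refine ⟨‖v‖⁻¹ • v, norm_smul_inv_norm hv, σ * P ‖v‖, ?_, rfl⟩
  rw [mem_Icc, ← abs_le, abs_mul, hσ, one_mul]
  exact (hP.abs_le_iff (norm_pos_iff.mpr hv)).mpr hv2

theorem polarNeck_smul_eq (hP : IsAxialProfile Λ P) (hP' : IsAxialProfile Λ P') {ξ : Euc n}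
    (hξ : ‖ξ‖ = 1) {t : ℝ} (ht : t ∈ Ioo (0 : ℝ) 1) :
    polarNeck N ((-1 : ℝ) • P) (t • ξ) = polarNeck N ((1 : ℝ) • P') ((1 - t) • ξ) := by
  rw [polarNeck_smul _ _ hξ ht.1, polarNeck_smul _ _ hξ (sub_pos.mpr ht.2), Pi.smul_apply,
    Pi.smul_apply, hP.eq_affine t ht.2.le, hP'.eq_affine (1 - t) (by linarith [ht.1])]
  congr 1
  simp only [smul_eq_mul]
  ring

variable [TopologicalSpace M] [ChartedSpace (Euc n) M]

theorem isLocalDiffeomorphAt_polarNeck [IsManifold (𝓡 n) ∞ M] (hP : IsAxialProfile Λ P)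
    (hσ : |σ| = 1) (hN : IsTopologicalNeck N (-(4 * Λ)) (4 * Λ)) (hv : v ≠ 0) :
    IsLocalDiffeomorphAt (𝓡 n) (𝓡 n) ∞ (polarNeck N (σ • P)) v := by
  have hσ0 : σ ≠ 0 := abs_ne_zero.mp (hσ.trans_ne one_ne_zero)
  refine NeckSurgery.isLocalDiffeomorphAt_polarNeck hN (hP.smooth.const_smul σ) (fun t ht => ?_)
    (fun t ht => hP.smul_mem_Ioo hσ ht) hv
  rw [deriv_fun_const_smul _ ((hP.smooth.contDiffAt (Ioi_mem_nhds ht)).differentiableAt (by simp))]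
  exact smul_ne_zero hσ0 (hP.deriv_pos t ht).ne'

theorem polarNeck_eq (hP : IsAxialProfile Λ P) (hP' : IsAxialProfile Λ P') (hσ : |σ| = 1)
    (hσ' : |σ'| = 1) (hN : IsTopologicalNeck N (-(4 * Λ)) (4 * Λ)) (hv : v ≠ 0) (hw : w ≠ 0)
    (h : polarNeck N (σ • P) v = polarNeck N (σ' • P') w) :
    ‖v‖⁻¹ • v = ‖w‖⁻¹ • w ∧ σ * P ‖v‖ = σ' * P' ‖w‖ :=
  hN.injective _ _ (norm_smul_inv_norm hv) (norm_smul_inv_norm hw)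
    _ (Ioo_subset_Icc_self (hP.smul_mem_Ioo hσ (norm_pos_iff.mpr hv)))
    _ (Ioo_subset_Icc_self (hP'.smul_mem_Ioo hσ' (norm_pos_iff.mpr hw))) h

theorem injOn_polarNeck (hP : IsAxialProfile Λ P) (hσ : |σ| = 1)
    (hN : IsTopologicalNeck N (-(4 * Λ)) (4 * Λ)) : InjOn (polarNeck N (σ • P)) {0}ᶜ := by
  intro v hv w hw h
  have hσ0 : σ ≠ 0 := abs_ne_zero.mp (hσ.trans_ne one_ne_zero)
  obtain ⟨hdir, hP_eq⟩ := hP.polarNeck_eq hP hσ hσ hN hv hw h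
  have hnorm : ‖v‖ = ‖w‖ := hP.strictMonoOn.injOn (norm_pos_iff.mpr hv) (norm_pos_iff.mpr hw)
    (mul_left_cancel₀ hσ0 hP_eq)
  rw [← smul_inv_smul₀ (norm_ne_zero_iff.mpr hv) v, hdir, hnorm,
    smul_inv_smul₀ (norm_ne_zero_iff.mpr hw)]

theorem glued_of_polarNeck_eq (hP : IsAxialProfile Λ P) (hP' : IsAxialProfile Λ P')
    (hN : IsTopologicalNeck N (-(4 * Λ)) (4 * Λ)) (hv : v ≠ 0) (hw : w ≠ 0)
    (h : polarNeck N ((-1 : ℝ) • P) v = polarNeck N ((1 : ℝ) • P') w) (i₁ i₂ : Euc n → M') :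
    Glued i₁ i₂ (i₁ v) (i₂ w) := by
  have hv' := norm_pos_iff.mpr hv
  have hw' := norm_pos_iff.mpr hw
  obtain ⟨hdir, hP_eq⟩ := hP.polarNeck_eq hP' (by norm_num) (by norm_num) hN hv hw h
  have hv1 : ‖v‖ < 1 := (hP.lt_half_iff hv').mp (by linarith [hP'.neg_half_lt hw'])
  have hw1 : ‖w‖ < 1 := (hP'.lt_half_iff hw').mp (by linarith [hP.neg_half_lt hv'])
  have hsum : 1 - ‖v‖ = ‖w‖ := by
    rw [hP.eq_affine _ hv1.le, hP'.eq_affine _ hw1.le] at hP_eq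
    exact mul_left_cancel₀ hP.pos.ne' (by linarith)
  refine ⟨‖v‖⁻¹ • v, norm_smul_inv_norm hv, ‖v‖, ⟨hv', hv1⟩, ?_, ?_⟩
  · rw [smul_inv_smul₀ (norm_ne_zero_iff.mpr hv)]
  · rw [hdir, hsum, smul_inv_smul₀ (norm_ne_zero_iff.mpr hw)]

end IsAxialProfile

variable [TopologicalSpace M] [ChartedSpace (Euc n) M] [TopologicalSpace M']
  [ChartedSpace (Euc n) M'] {j : M → M'} {i₁ i₂ : Euc n → M'}
  {P₁ P₂ : ℝ → ℝ} {f : M' → M}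

/-- `M'` is the union of the complement of the core of a neck in `M`, embedded by `j`, and of two
disjoint discs, which are attached along the two ends of the neck. -/
structure IsCappedOff (N : Euc n → ℝ → M) (Λ : ℝ) (j : M → M') (i₁ i₂ : Euc n → M')
    (P₁ P₂ : ℝ → ℝ) : Prop where
  neck : IsTopologicalNeck N (-(4 * Λ)) (4 * Λ)
  localDiffeo : IsLocalDiffeomorphOn (𝓡 n) (𝓡 n) ∞ j (core N Λ)ᶜ
  injOn : InjOn j (core N Λ)ᶜ
  disc₁ : IsCollarDisc N Λ (-1) j i₁ P₁
  disc₂ : IsCollarDisc N Λ 1 j i₂ P₂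
  disjoint : Disjoint (range i₁) (range i₂)
  cover : j '' (core N Λ)ᶜ ∪ range i₁ ∪ range i₂ = univ

/-- `f` undoes the surgery: it is inverse to `j`, and maps both punctured discs to the neck in polar
coordinates. Its values at the centres of the discs are arbitrary. -/
structure IsRegluing (N : Euc n → ℝ → M) (Λ : ℝ) (j : M → M') (i₁ i₂ : Euc n → M')
    (P₁ P₂ : ℝ → ℝ) (f : M' → M) : Prop extends IsCappedOff N Λ j i₁ i₂ P₁ P₂ where
  apply_j : ∀ x ∉ core N Λ, f (j x) = x
  apply_disc₁ : ∀ v, f (i₁ v) = polarNeck N ((-1 : ℝ) • P₁) v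
  apply_disc₂ : ∀ v, f (i₂ v) = polarNeck N ((1 : ℝ) • P₂) v

theorem IsStandardSurgery.exists_isCappedOff {d : ℕ} {F : M → Euc d} {τ B : ℝ} {F' : M' → Euc d}
    (hΛ : 0 < Λ) (hN : IsTopologicalNeck N (-(4 * Λ)) (4 * Λ))
    (h : IsStandardSurgery F N Λ τ B F') :
    ∃ (j : M → M') (i₁ i₂ : Euc n → M') (P₁ P₂ : ℝ → ℝ), IsCappedOff N Λ j i₁ i₂ P₁ P₂ := by
  obtain ⟨φ, Q, j, c₁, c₂, -, -, hj, hj_inj, -, hc₁, hc₂, hdisj, hcover⟩ := h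
  obtain ⟨i₁, P₁, h₁, hr₁⟩ := hc₁.exists_isCollarDisc hΛ
  obtain ⟨i₂, P₂, h₂, hr₂⟩ := hc₂.exists_isCollarDisc hΛ
  rw [← hr₁, ← hr₂] at hdisj hcover
  rw [neg_neg] at h₂
  exact ⟨j, i₁, i₂, P₁, P₂, hN, hj, hj_inj, h₁, h₂, hdisj, hcover⟩

open Classical in
theorem IsCappedOff.exists_isRegluing [Nonempty M] (h : IsCappedOff N Λ j i₁ i₂ P₁ P₂) :
    ∃ f, IsRegluing N Λ j i₁ i₂ P₁ P₂ f := by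
  refine ⟨fun y => if y ∈ range i₁ then polarNeck N ((-1 : ℝ) • P₁) (Function.invFun i₁ y)
    else if y ∈ range i₂ then polarNeck N ((1 : ℝ) • P₂) (Function.invFun i₂ y)
    else Function.invFunOn j (core N Λ)ᶜ y, h, fun x hx => ?_, fun v => ?_, fun v => ?_⟩
  · split_ifs with h₁ h₂
    · obtain ⟨v, hv⟩ := h₁
      rw [← hv, Function.leftInverse_invFun h.disc₁.isDisc.2, (h.disc₁.of_eq x hx v hv.symm).2]
    · obtain ⟨v, hv⟩ := h₂
      rw [← hv, Function.leftInverse_invFun h.disc₂.isDisc.2, (h.disc₂.of_eq x hx v hv.symm).2]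
    · exact h.injOn.leftInvOn_invFunOn hx
  · rw [if_pos (mem_range_self v), Function.leftInverse_invFun h.disc₁.isDisc.2]
  · rw [if_neg fun h₁ => disjoint_left.mp h.disjoint h₁ (mem_range_self v),
      if_pos (mem_range_self v), Function.leftInverse_invFun h.disc₂.isDisc.2]

namespace IsRegluing

theorem cases (h : IsRegluing N Λ j i₁ i₂ P₁ P₂ f) {y : M'} (hy : y ∈ ({i₁ 0, i₂ 0}ᶜ : Set M')) :
    (∃ x ∉ core N Λ, y = j x) ∨ (∃ v ≠ 0, y = i₁ v) ∨ ∃ v ≠ 0, y = i₂ v := by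
  simp only [mem_compl_iff, mem_insert_iff, mem_singleton_iff, not_or] at hy
  rcases h.cover.superset (mem_univ y) with (⟨x, hx, rfl⟩ | ⟨v, rfl⟩) | ⟨v, rfl⟩
  · exact Or.inl ⟨x, hx, rfl⟩
  · exact Or.inr (Or.inl ⟨v, fun hv => hy.1 (by rw [hv]), rfl⟩)
  · exact Or.inr (Or.inr ⟨v, fun hv => hy.2 (by rw [hv]), rfl⟩)

theorem disc₁_mem (h : IsRegluing N Λ j i₁ i₂ P₁ P₂ f) (hv : v ≠ 0) :
    i₁ v ∈ ({i₁ 0, i₂ 0}ᶜ : Set M') := by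
  rintro (h₁ | h₂)
  · exact hv (h.disc₁.isDisc.2 h₁)
  · exact disjoint_left.mp h.disjoint (mem_range_self v) ⟨0, (mem_singleton_iff.mp h₂).symm⟩

theorem disc₂_mem (h : IsRegluing N Λ j i₁ i₂ P₁ P₂ f) (hv : v ≠ 0) :
    i₂ v ∈ ({i₁ 0, i₂ 0}ᶜ : Set M') := by
  rintro (h₁ | h₂)
  · exact disjoint_left.mp h.disjoint ⟨0, h₁.symm⟩ (mem_range_self v)
  · exact hv (h.disc₂.isDisc.2 h₂)

theorem j_mem (h : IsRegluing N Λ j i₁ i₂ P₁ P₂ f) {x : M} (hx : x ∉ core N Λ) :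
    j x ∈ ({i₁ 0, i₂ 0}ᶜ : Set M') := by
  have hnorm : ¬ 2 < ‖(0 : Euc n)‖ := by norm_num
  rintro (h₁ | h₂)
  · exact hnorm (h.disc₁.of_eq x hx 0 h₁).1
  · exact hnorm (h.disc₂.of_eq x hx 0 h₂).1

theorem j_apply (h : IsRegluing N Λ j i₁ i₂ P₁ P₂ f) {y : M'} (hy : y ∈ ({i₁ 0, i₂ 0}ᶜ : Set M'))
    (hfy : f y ∉ core N Λ) : j (f y) = y := by
  rcases h.cases hy with ⟨x, hx, rfl⟩ | ⟨v, hv, rfl⟩ | ⟨v, hv, rfl⟩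
  · rw [h.apply_j x hx]
  · rw [h.apply_disc₁] at hfy ⊢
    refine (h.disc₁.collar v (not_le.mp fun hv2 => hfy ?_)).symm
    exact h.disc₁.profile.polarNeck_mem_core (by norm_num) hv hv2
  · rw [h.apply_disc₂] at hfy ⊢
    refine (h.disc₂.collar v (not_le.mp fun hv2 => hfy ?_)).symm
    exact h.disc₂.profile.polarNeck_mem_core (by norm_num) hv hv2

theorem isLocalDiffeomorphOn [T2Space M] [IsManifold (𝓡 n) ∞ M]
    (h : IsRegluing N Λ j i₁ i₂ P₁ P₂ f) :
    IsLocalDiffeomorphOn (𝓡 n) (𝓡 n) ∞ f {i₁ 0, i₂ 0}ᶜ := by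
  rintro ⟨y, hy⟩
  rcases h.cases hy with ⟨x, hx, rfl⟩ | ⟨v, hv, rfl⟩ | ⟨v, hv, rfl⟩
  · refine isLocalDiffeomorphAt_of_comp_right (h := id)
      ((Diffeomorph.refl (𝓡 n) M ∞).isLocalDiffeomorph x) (h.localDiffeo ⟨x, hx⟩) ?_
    filter_upwards [(isCompact_core h.neck).isClosed.isOpen_compl.mem_nhds hx] using h.apply_j
  · exact isLocalDiffeomorphAt_of_comp_right (f := i₁) (g := f)
      (h.disc₁.profile.isLocalDiffeomorphAt_polarNeck (by norm_num) h.neck hv)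
      (h.disc₁.isDisc.1 v) (.of_forall h.apply_disc₁)
  · exact isLocalDiffeomorphAt_of_comp_right (f := i₂) (g := f)
      (h.disc₂.profile.isLocalDiffeomorphAt_polarNeck (by norm_num) h.neck hv)
      (h.disc₂.isDisc.1 v) (.of_forall h.apply_disc₂)

theorem image_eq_univ (h : IsRegluing N Λ j i₁ i₂ P₁ P₂ f) : f '' {i₁ 0, i₂ 0}ᶜ = univ := by
  refine eq_univ_of_forall fun x => ?_
  by_cases hx : x ∈ core N Λ
  · obtain ⟨ξ, hξ, z, hz, rfl⟩ := hx
    have hξ0 : ξ ≠ 0 := norm_ne_zero_iff.mp (hξ.trans_ne one_ne_zero)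
    rcases le_total z 0 with hz0 | hz0
    · obtain ⟨t, ht, htz⟩ := h.disc₁.profile.exists_eq (z := -z) ⟨by linarith, by linarith [hz.1]⟩
      refine ⟨i₁ (t • ξ), h.disc₁_mem (smul_ne_zero ht.1.ne' hξ0), ?_⟩
      rw [h.apply_disc₁, polarNeck_smul _ _ hξ ht.1, Pi.smul_apply, htz, neg_one_smul, neg_neg]
    · obtain ⟨t, ht, htz⟩ := h.disc₂.profile.exists_eq (z := z) ⟨hz0, hz.2⟩
      refine ⟨i₂ (t • ξ), h.disc₂_mem (smul_ne_zero ht.1.ne' hξ0), ?_⟩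
      rw [h.apply_disc₂, polarNeck_smul _ _ hξ ht.1, Pi.smul_apply, htz, one_smul]
  · exact ⟨j x, h.j_mem hx, h.apply_j x hx⟩

theorem apply_eq_of_glued (h : IsRegluing N Λ j i₁ i₂ P₁ P₂ f) {x y : M'}
    (hxy : Glued i₁ i₂ x y) : f x = f y := by
  obtain ⟨ξ, hξ, t, ht, rfl, rfl⟩ := hxy
  rw [h.apply_disc₁, h.apply_disc₂, h.disc₁.profile.polarNeck_smul_eq h.disc₂.profile hξ ht]

theorem eq_or_glued_of_apply_eq (h : IsRegluing N Λ j i₁ i₂ P₁ P₂ f) {x y : M'}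
    (hx : x ∈ ({i₁ 0, i₂ 0}ᶜ : Set M')) (hy : y ∈ ({i₁ 0, i₂ 0}ᶜ : Set M')) (hxy : f x = f y) :
    x = y ∨ Glued i₁ i₂ x y ∨ Glued i₁ i₂ y x := by
  by_cases hcore : f x ∈ core N Λ
  swap
  · exact Or.inl (by rw [← h.j_apply hx hcore, hxy, h.j_apply hy (hxy ▸ hcore)])
  have hj {a : M} (ha : a ∉ core N Λ) (hmem : f (j a) ∈ core N Λ) : False :=
    ha (h.apply_j a ha ▸ hmem)
  have hP₁ := h.disc₁.profile
  have hP₂ := h.disc₂.profile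
  rcases h.cases hx with ⟨a, ha, rfl⟩ | ⟨v, hv, rfl⟩ | ⟨v, hv, rfl⟩
  · exact (hj ha hcore).elim
  all_goals rcases h.cases hy with ⟨b, hb, rfl⟩ | ⟨w, hw, rfl⟩ | ⟨w, hw, rfl⟩
  · exact (hj hb (hxy ▸ hcore)).elim
  · rw [h.apply_disc₁, h.apply_disc₁] at hxy
    exact Or.inl (congrArg i₁ (hP₁.injOn_polarNeck (by norm_num) h.neck hv hw hxy))
  · rw [h.apply_disc₁, h.apply_disc₂] at hxy
    exact Or.inr (Or.inl (hP₁.glued_of_polarNeck_eq hP₂ h.neck hv hw hxy i₁ i₂))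
  · exact (hj hb (hxy ▸ hcore)).elim
  · rw [h.apply_disc₂, h.apply_disc₁] at hxy
    exact Or.inr (Or.inr (hP₁.glued_of_polarNeck_eq hP₂ h.neck hw hv hxy.symm i₁ i₂))
  · rw [h.apply_disc₂, h.apply_disc₂] at hxy
    exact Or.inl (congrArg i₂ (hP₂.injOn_polarNeck (by norm_num) h.neck hv hw hxy))

end IsRegluing

/-- `f` is the quotient map which glues the discs `i₁` and `i₂`, with disjoint ranges, to form the
connected sum `M` of `M'` with itself. Unlike in `IsSelfConnectedSum`, the open discs are disjoint
as well, and the discs and `f` are not existentially quantified. -/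
structure IsSelfGluing (i₁ i₂ : Euc n → M') (f : M' → M) : Prop where
  disc₁ : IsDisc i₁
  disc₂ : IsDisc i₂
  disjoint : Disjoint (range i₁) (range i₂)
  localDiffeo : IsLocalDiffeomorphOn (𝓡 n) (𝓡 n) ∞ f {i₁ 0, i₂ 0}ᶜ
  surj : f '' {i₁ 0, i₂ 0}ᶜ = univ
  eq_iff : ∀ x ∈ ({i₁ 0, i₂ 0}ᶜ : Set M'), ∀ y ∈ ({i₁ 0, i₂ 0}ᶜ : Set M'),
    f x = f y ↔ x = y ∨ Glued i₁ i₂ x y ∨ Glued i₁ i₂ y x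

theorem IsRegluing.isSelfGluing [T2Space M] [IsManifold (𝓡 n) ∞ M]
    (h : IsRegluing N Λ j i₁ i₂ P₁ P₂ f) : IsSelfGluing i₁ i₂ f where
  disc₁ := h.disc₁.isDisc
  disc₂ := h.disc₂.isDisc
  disjoint := h.disjoint
  localDiffeo := h.isLocalDiffeomorphOn
  surj := h.image_eq_univ
  eq_iff _ hx _ hy := ⟨h.eq_or_glued_of_apply_eq hx hy, by
    rintro (rfl | hxy | hxy)
    exacts [rfl, h.apply_eq_of_glued hxy, (h.apply_eq_of_glued hxy).symm]⟩

theorem IsStandardSurgery.exists_isSelfGluing [T2Space M] [Nonempty M] [IsManifold (𝓡 n) ∞ M]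
    {d : ℕ} {F : M → Euc d} {τ B : ℝ} {F' : M' → Euc d} (hΛ : 0 < Λ)
    (hN : IsTopologicalNeck N (-(4 * Λ)) (4 * Λ)) (h : IsStandardSurgery F N Λ τ B F') :
    ∃ (i₁ i₂ : Euc n → M') (f : M' → M), IsSelfGluing i₁ i₂ f := by
  obtain ⟨j, i₁, i₂, P₁, P₂, hcap⟩ := h.exists_isCappedOff hΛ hN
  obtain ⟨f, hf⟩ := hcap.exists_isRegluing
  exact ⟨i₁, i₂, f, hf.isSelfGluing⟩

end Regluing

section ConnectedSum

open Filter Topology TopologicalSpace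

variable {n : ℕ}

namespace Glued

variable {M₁ M₂ : Type*} {i₁ : Euc n → M₁} {i₂ : Euc n → M₂} {x : M₁} {y : M₂}

theorem swap (h : Glued i₁ i₂ x y) : Glued i₂ i₁ y x := by
  obtain ⟨ξ, hξ, t, ht, hx, hy⟩ := h
  exact ⟨ξ, hξ, 1 - t, ⟨by linarith [ht.2], by linarith [ht.1]⟩, hy, by rw [sub_sub_cancel, hx]⟩

theorem mem_image_ball_left (h : Glued i₁ i₂ x y) : x ∈ i₁ '' Metric.ball 0 1 := by
  obtain ⟨ξ, hξ, t, ht, rfl, -⟩ := h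
  refine mem_image_of_mem _ ?_
  rw [mem_ball_zero_iff, norm_smul, hξ, mul_one, Real.norm_of_nonneg ht.1.le]
  exact ht.2

theorem mem_range_left (h : Glued i₁ i₂ x y) : x ∈ range i₁ :=
  image_subset_range _ _ h.mem_image_ball_left

theorem mem_range_right (h : Glued i₁ i₂ x y) : y ∈ range i₂ := h.swap.mem_range_left

end Glued

theorem coe_mem_of_ne {M' : Type*} [TopologicalSpace M'] {i₁ i₂ : Euc n → M'}
    {U : Opens M'} (h₁ : ∀ v, i₁ v ∈ U) (h₂ : ∀ v, i₂ v ∉ U) {x : U} (hx : x ≠ ⟨i₁ 0, h₁ 0⟩) :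
    (x : M') ∈ ({i₁ 0, i₂ 0}ᶜ : Set M') := by
  rintro (hx' | hx')
  · exact hx (Subtype.ext hx')
  · exact h₂ 0 (mem_singleton_iff.mp hx' ▸ x.2)

variable {M M' : Type*} [TopologicalSpace M] [ChartedSpace (Euc n) M]
  [TopologicalSpace M'] [ChartedSpace (Euc n) M'] {i i₁ i₂ : Euc n → M'} {f : M' → M}

theorem IsDisc.continuous (h : IsDisc i) : Continuous i :=
  h.1.contMDiff.continuous

theorem IsDisc.isConnected_range (h : IsDisc i) : IsConnected (range i) :=
  _root_.isConnected_range h.continuous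

theorem IsDisc.codRestrict (h : IsDisc i) {U : Opens M'} (hU : ∀ v, i v ∈ U) :
    IsDisc fun v => (⟨i v, hU v⟩ : U) := by
  refine ⟨fun v => ?_, fun v w hvw => h.2 (congrArg Subtype.val hvw)⟩
  exact isLocalDiffeomorphAt_of_comp_left (h.1 v) (isLocalDiffeomorphAt_subtype_val U _)
    (h.continuous.subtype_mk hU).continuousAt EventuallyEq.rfl

namespace IsSelfGluing

theorem swap (h : IsSelfGluing i₁ i₂ f) : IsSelfGluing i₂ i₁ f where
  disc₁ := h.disc₂
  disc₂ := h.disc₁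
  disjoint := h.disjoint.symm
  localDiffeo := pair_comm (i₁ 0) (i₂ 0) ▸ h.localDiffeo
  surj := pair_comm (i₁ 0) (i₂ 0) ▸ h.surj
  eq_iff x hx y hy := by
    rw [pair_comm] at hx hy
    have hswap (x y : M') : Glued i₁ i₂ x y ↔ Glued i₂ i₁ y x := ⟨Glued.swap, Glued.swap⟩
    rw [h.eq_iff x hx y hy, hswap x y, hswap y x, or_comm (a := Glued i₂ i₁ y x)]

theorem isSelfConnectedSum (h : IsSelfGluing i₁ i₂ f) : IsSelfConnectedSum n M' M :=
  ⟨i₁, i₂, f, h.disc₁, h.disc₂, h.disjoint.mono (image_subset_range _ _) (image_subset_range _ _),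
    h.localDiffeo, h.surj, h.eq_iff⟩

theorem disc₁_mem (h : IsSelfGluing i₁ i₂ f) {v : Euc n} (hv : v ≠ 0) :
    i₁ v ∈ ({i₁ 0, i₂ 0}ᶜ : Set M') := by
  rintro (h₁ | h₂)
  · exact hv (h.disc₁.2 h₁)
  · exact disjoint_left.mp h.disjoint (mem_range_self v) ⟨0, (mem_singleton_iff.mp h₂).symm⟩

theorem range_subset_or_range_subset [NeZero n] [ConnectedSpace M] (h : IsSelfGluing i₁ i₂ f)
    {U : Set M'} (hU : IsClopen U) (hne : U.Nonempty) : range i₁ ⊆ U ∨ range i₂ ⊆ U := by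
  by_contra! hcon
  have hdisj {i : Euc n → M'} (hi : IsDisc i) (hiU : ¬ range i ⊆ U) : ∀ x ∈ U, x ∉ range i :=
    fun x hx hxi => hiU (hi.isConnected_range.isPreconnected.subset_isClopen hU ⟨x, hxi, hx⟩)
  have h₁ := hdisj h.disc₁ hcon.1
  have h₂ := hdisj h.disc₂ hcon.2
  have hsub : U ⊆ {i₁ 0, i₂ 0}ᶜ := by
    rintro x hx (rfl | rfl)
    exacts [h₁ _ hx (mem_range_self 0), h₂ _ hx (mem_range_self 0)]
  have hsep : ∀ x ∈ U, ∀ y ∈ Uᶜ \ {i₁ 0, i₂ 0}, f x ≠ f y := by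
    intro x hx y hy hxy
    rcases (h.eq_iff x (hsub hx) y hy.2).mp hxy with rfl | hg | hg
    exacts [hy.1 hx, h₁ x hx hg.mem_range_left, h₂ x hx hg.mem_range_right]
  have hcompl : (f '' U)ᶜ = f '' (Uᶜ \ {i₁ 0, i₂ 0}) := by
    ext z
    obtain ⟨y, hy, rfl⟩ := h.surj.superset (mem_univ z)
    refine ⟨fun hz => ⟨y, ⟨fun hyU => hz ⟨y, hyU, rfl⟩, hy⟩, rfl⟩, ?_⟩
    rintro ⟨y', hy', hyy'⟩ ⟨x, hx, hxy⟩
    exact hsep x hx y' hy' (hxy.trans hyy'.symm)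
  have hopen : IsOpen (f '' U) := isOpen_image_of_isLocalDiffeomorphOn h.localDiffeo hU.isOpen hsub
  have hopen' : IsOpen (f '' (Uᶜ \ {i₁ 0, i₂ 0})) := by
    have : T1Space M' := ChartedSpace.t1Space (Euc n) M'
    exact isOpen_image_of_isLocalDiffeomorphOn h.localDiffeo
      (hU.compl.isOpen.sdiff (toFinite {i₁ 0, i₂ 0}).isClosed) fun y hy => hy.2
  have huniv : f '' U = univ :=
    IsClopen.eq_univ ⟨⟨hcompl ▸ hopen'⟩, hopen⟩ (hne.image f)
  obtain ⟨v, hv⟩ := exists_ne (0 : Euc n)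
  obtain ⟨x, hx, hxv⟩ := huniv.superset (mem_univ (f (i₁ v)))
  exact hsep x hx _ ⟨fun hvU => h₁ _ hvU (mem_range_self v), h.disc₁_mem hv⟩ hxv

theorem exists_isCompl_connectedSpace [NeZero n] [ConnectedSpace M] (h : IsSelfGluing i₁ i₂ f)
    (hM' : ¬ ConnectedSpace M') :
    ∃ M₁ M₂ : Opens M', ConnectedSpace M₁ ∧ ConnectedSpace M₂ ∧ IsCompl M₁ M₂ := by
  have : LocallyConnectedSpace M' := ChartedSpace.locallyConnectedSpace (Euc n) M'
  let C (x : M') : Opens M' := ⟨connectedComponent x, isOpen_connectedComponent⟩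
  have hC (x : M') : ConnectedSpace (C x) :=
    isConnected_iff_connectedSpace.mp isConnected_connectedComponent
  have hunion : connectedComponent (i₁ 0) ∪ connectedComponent (i₂ 0) = univ := by
    by_contra hcon
    have hclopen : IsClopen (connectedComponent (i₁ 0) ∪ connectedComponent (i₂ 0))ᶜ :=
      (isClopen_connectedComponent.union isClopen_connectedComponent).compl
    rcases h.range_subset_or_range_subset hclopen (nonempty_compl.mpr hcon) with hs | hs
    · exact hs (mem_range_self 0) (Or.inl mem_connectedComponent)
    · exact hs (mem_range_self 0) (Or.inr mem_connectedComponent)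
  have hne : connectedComponent (i₁ 0) ≠ connectedComponent (i₂ 0) := by
    intro heq
    rw [← heq, union_self] at hunion
    exact hM' (connectedSpace_iff_univ.mpr (hunion ▸ isConnected_connectedComponent))
  refine ⟨C (i₁ 0), C (i₂ 0), hC _, hC _, IsCompl.of_eq ?_ ?_⟩
  · exact Opens.ext (disjoint_iff_inter_eq_empty.mp (connectedComponent_disjoint hne))
  · exact Opens.ext hunion

theorem isLocalDiffeomorphOn_restrict (h : IsSelfGluing i₁ i₂ f) {U : Opens M'}
    (h₁ : ∀ v, i₁ v ∈ U) (h₂ : ∀ v, i₂ v ∉ U) :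
    IsLocalDiffeomorphOn (𝓡 n) (𝓡 n) ∞ (fun x : U => f x) {⟨i₁ 0, h₁ 0⟩}ᶜ := fun ⟨x, hx⟩ =>
  (isLocalDiffeomorphAt_subtype_val U x).comp _ _ (h.localDiffeo ⟨x, coe_mem_of_ne h₁ h₂ hx⟩)

theorem injOn_restrict (h : IsSelfGluing i₁ i₂ f) {U : Opens M'} (h₁ : ∀ v, i₁ v ∈ U)
    (h₂ : ∀ v, i₂ v ∉ U) : InjOn (fun x : U => f x) {⟨i₁ 0, h₁ 0⟩}ᶜ := by
  have hnot (x y : U) : ¬ Glued i₁ i₂ (x : M') y := fun hg => by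
    obtain ⟨v, hv⟩ := hg.mem_range_right
    exact h₂ v (hv ▸ y.2)
  intro x hx y hy hxy
  rcases (h.eq_iff x (coe_mem_of_ne h₁ h₂ hx) y (coe_mem_of_ne h₁ h₂ hy)).mp hxy with he | hg | hg
  exacts [Subtype.ext he, (hnot x y hg).elim, (hnot y x hg).elim]

theorem isConnectedSum (h : IsSelfGluing i₁ i₂ f) {M₁ M₂ : Opens M'} (hM : IsCompl M₁ M₂)
    (h₁ : ∀ v, i₁ v ∈ M₁) (h₂ : ∀ v, i₂ v ∈ M₂) : IsConnectedSum n M₁ M₂ M := by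
  have hdisj {x : M'} (hx₁ : x ∈ M₁) (hx₂ : x ∈ M₂) : False :=
    (disjoint_iff_inf_le.mp hM.disjoint : M₁ ⊓ M₂ ≤ ⊥) ⟨hx₁, hx₂⟩
  have h₁' (v : Euc n) : i₁ v ∉ M₂ := fun hv => hdisj (h₁ v) hv
  have h₂' (v : Euc n) : i₂ v ∉ M₁ := fun hv => hdisj hv (h₂ v)
  have hmem₁ {x : M₁} (hx : x ≠ ⟨i₁ 0, h₁ 0⟩) := coe_mem_of_ne h₁ h₂' hx
  have hmem₂ {x : M₂} (hx : x ≠ ⟨i₂ 0, h₂ 0⟩) : (x : M') ∈ ({i₁ 0, i₂ 0}ᶜ : Set M') :=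
    pair_comm (i₁ 0) (i₂ 0) ▸ coe_mem_of_ne h₂ h₁' hx
  refine ⟨fun v => ⟨i₁ v, h₁ v⟩, fun v => ⟨i₂ v, h₂ v⟩, fun x => f x, fun x => f x,
    h.disc₁.codRestrict h₁, h.disc₂.codRestrict h₂, h.isLocalDiffeomorphOn_restrict h₁ h₂',
    h.injOn_restrict h₁ h₂', h.swap.isLocalDiffeomorphOn_restrict h₂ h₁',
    h.swap.injOn_restrict h₂ h₁', eq_univ_of_forall fun z => ?_, fun x hx y hy => ?_⟩
  · obtain ⟨x, hx, rfl⟩ := h.surj.superset (mem_univ z)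
    rcases (codisjoint_iff_le_sup.mp hM.codisjoint : ⊤ ≤ M₁ ⊔ M₂) (mem_univ x) with hx' | hx'
    · exact Or.inl ⟨⟨x, hx'⟩, fun he => hx (Or.inl (congrArg Subtype.val he)), rfl⟩
    · exact Or.inr ⟨⟨x, hx'⟩, fun he => hx (Or.inr (congrArg Subtype.val he)), rfl⟩
  · rw [h.eq_iff x (hmem₁ hx) y (hmem₂ hy)]
    constructor
    · rintro (he | ⟨ξ, hξ, t, ht, hx', hy'⟩ | hg)
      · exact (hdisj x.2 (he ▸ y.2)).elim
      · exact ⟨ξ, hξ, t, ht, Subtype.ext hx', Subtype.ext hy'⟩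
      · obtain ⟨v, hv⟩ := hg.mem_range_left
        exact (h₁' v (hv ▸ y.2)).elim
    · rintro ⟨ξ, hξ, t, ht, rfl, rfl⟩
      exact Or.inr (Or.inl ⟨ξ, hξ, t, ht, rfl, rfl⟩)

theorem isConnectedSum_of_isCompl [NeZero n] [ConnectedSpace M] (h : IsSelfGluing i₁ i₂ f)
    {M₁ M₂ : Opens M'} [h₁ : Nonempty M₁] [h₂ : Nonempty M₂] (hM : IsCompl M₁ M₂) :
    IsConnectedSum n M₁ M₂ M := by
  have hcompl : (M₁ : Set M')ᶜ = M₂ := by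
    have hd : (M₁ : Set M') ⊓ M₂ = ⊥ := congrArg ((↑) : Opens M' → Set M') hM.inf_eq_bot
    have hu : (M₁ : Set M') ⊔ M₂ = ⊤ := congrArg ((↑) : Opens M' → Set M') hM.sup_eq_top
    exact (IsCompl.of_eq hd hu).compl_eq
  have hclopen₁ : IsClopen (M₁ : Set M') := ⟨⟨hcompl ▸ M₂.isOpen⟩, M₁.isOpen⟩
  have hclopen₂ : IsClopen (M₂ : Set M') := hcompl ▸ hclopen₁.compl
  have hnot (i : Euc n → M') (hi : range i ⊆ M₁) (hi' : range i ⊆ M₂) : False := by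
    rw [← hcompl] at hi'
    exact hi' (mem_range_self 0) (hi (mem_range_self 0))
  rcases h.range_subset_or_range_subset hclopen₁ (nonempty_subtype.mp h₁) with a | a <;>
  rcases h.range_subset_or_range_subset hclopen₂ (nonempty_subtype.mp h₂) with b | b
  · exact (hnot _ a b).elim
  · exact h.isConnectedSum hM (range_subset_iff.mp a) (range_subset_iff.mp b)
  · exact h.swap.isConnectedSum hM (range_subset_iff.mp a) (range_subset_iff.mp b)
  · exact (hnot _ a b).elim

end IsSelfGluing

end ConnectedSum

section GermExtension

open Filter Topology Metric

variable {E F : Type*} [NormedAddCommGroup E] [NormedSpace ℝ E] [NormedAddCommGroup F]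
  [NormedSpace ℝ F]

theorem exists_cutoff_norm_fderiv_le [HasContDiffBump E] [FiniteDimensional ℝ E] :
    ∃ C > 0, ∀ r > 0, ∃ χ : E → ℝ, ContDiff ℝ ∞ χ ∧ (∀ y, ‖χ y‖ ≤ 1) ∧
      (∀ᶠ y in 𝓝 0, χ y = 1) ∧ tsupport χ ⊆ closedBall 0 r ∧ ∀ y, ‖fderiv ℝ χ y‖ ≤ C / r := by
  let b : ContDiffBump (0 : E) := ⟨1 / 2, 1, one_half_pos, one_half_lt_one⟩
  obtain ⟨C, hC⟩ : ∃ C, LipschitzWith C b :=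
    ContDiff.lipschitzWith_of_hasCompactSupport b.hasCompactSupport (b.contDiff (n := 1)) (by simp)
  refine ⟨C + 1, by positivity, fun r hr => ⟨fun y => b (r⁻¹ • y),
    b.contDiff.comp (contDiff_const_smul r⁻¹),
    fun y => (Real.norm_of_nonneg b.nonneg).trans_le b.le_one, ?_,
    closure_minimal (fun y hy => ?_) isClosed_closedBall, fun y => ?_⟩⟩
  · have hscale : Tendsto (fun y : E => r⁻¹ • y) (𝓝 0) (𝓝 0) := by
      simpa using (continuous_const_smul r⁻¹).tendsto (0 : E)
    exact hscale.eventually b.eventuallyEq_one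
  · have hy : r⁻¹ • y ∈ ball (0 : E) 1 := b.support_eq ▸ hy
    rw [mem_ball_zero_iff, norm_smul, norm_inv, Real.norm_of_nonneg hr.le, inv_mul_eq_div,
      div_lt_one hr] at hy
    exact mem_closedBall_zero_iff.mpr hy.le
  · have hlip : LipschitzWith (C * ‖r⁻¹‖₊) fun y => b (r⁻¹ • y) :=
      hC.comp (lipschitzWith_smul r⁻¹)
    calc ‖fderiv ℝ (fun y => b (r⁻¹ • y)) y‖ ≤ C * ‖r⁻¹‖ := norm_fderiv_le_of_lipschitz ℝ hlip
      _ = C / r := by rw [norm_inv, Real.norm_of_nonneg hr.le, div_eq_mul_inv]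
      _ ≤ (C + 1) / r := by gcongr; exact le_add_of_nonneg_right zero_le_one

theorem norm_fderiv_smul_le {χ : E → ℝ} {h : E → F} {r δ C : ℝ} (hr : 0 < r)
    (hh : ∀ z ∈ closedBall 0 r, DifferentiableAt ℝ h z)
    (hh' : ∀ z ∈ closedBall 0 r, ‖fderiv ℝ h z‖ ≤ δ) (h0 : h 0 = 0) {y : E}
    (hy : y ∈ closedBall 0 r) (hχ : DifferentiableAt ℝ χ y) (hχ1 : ‖χ y‖ ≤ 1)
    (hχ' : ‖fderiv ℝ χ y‖ ≤ C / r) : ‖fderiv ℝ (fun z => χ z • h z) y‖ ≤ (1 + C) * δ := by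
  have hhy : ‖h y‖ ≤ δ * r := by
    have hmvt := (convex_closedBall (0 : E) r).norm_image_sub_le_of_norm_fderiv_le hh hh'
      (mem_closedBall_self hr.le) hy
    rw [h0, sub_zero, sub_zero] at hmvt
    have hδ : 0 ≤ δ := (norm_nonneg _).trans (hh' y hy)
    exact hmvt.trans (by gcongr; exact mem_closedBall_zero_iff.mp hy)
  rw [fderiv_fun_smul hχ (hh y hy)]
  calc ‖χ y • fderiv ℝ h y + (fderiv ℝ χ y).smulRight (h y)‖
      ≤ ‖χ y‖ * ‖fderiv ℝ h y‖ + ‖fderiv ℝ χ y‖ * ‖h y‖ := by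
        rw [← norm_smul, ← ContinuousLinearMap.norm_smulRight_apply]
        exact norm_add_le _ _
    _ ≤ 1 * δ + C / r * (δ * r) := by
        gcongr
        · exact hh' y hy
        · exact (norm_nonneg _).trans hχ'
    _ = (1 + C) * δ := by field_simp

theorem exists_contDiff_norm_fderiv_le_eventuallyEq [HasContDiffBump E] [FiniteDimensional ℝ E]
    {h : E → F} {U : Set E} (hU : U ∈ 𝓝 0) (hh : ContDiffOn ℝ ∞ h U) (h0 : h 0 = 0)
    (h0' : fderiv ℝ h 0 = 0) {ε : ℝ} (hε : 0 < ε) :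
    ∃ φ : E → F, ContDiff ℝ ∞ φ ∧ HasCompactSupport φ ∧ (∀ y, ‖fderiv ℝ φ y‖ ≤ ε) ∧
      φ =ᶠ[𝓝 0] h := by
  obtain ⟨C, hC, hcut⟩ := exists_cutoff_norm_fderiv_le (E := E)
  have hC1 : 0 < 1 + C := by positivity
  obtain ⟨r, hr, hr'⟩ : ∃ r > 0, ∀ y ∈ closedBall (0 : E) r,
      ContDiffAt ℝ ∞ h y ∧ ‖fderiv ℝ h y‖ ≤ ε / (1 + C) := by
    have hsmooth : ∀ᶠ y in 𝓝 0, ContDiffAt ℝ ∞ h y :=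
      (eventually_mem_nhds_iff.mpr hU).mono fun y hy => hh.contDiffAt hy
    have hsmall : ∀ᶠ y in 𝓝 0, ‖fderiv ℝ h y‖ ≤ ε / (1 + C) :=
      (((hh.contDiffAt hU).continuousAt_fderiv (by simp)).norm.eventually_lt continuousAt_const
        (by rw [h0', norm_zero]; positivity)).mono fun y hy => hy.le
    exact nhds_basis_closedBall.eventually_iff.mp (hsmooth.and hsmall)
  obtain ⟨χ, hχ, hχ1, hχ0, hsupp, hχ'⟩ := hcut r hr
  replace hsupp : tsupport (fun y => χ y • h y) ⊆ closedBall 0 r :=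
    (tsupport_smul_subset_left χ h).trans hsupp
  refine ⟨fun y => χ y • h y, ContMDiff.contDiff (contMDiff_of_tsupport fun y hy =>
      (hχ.contDiffAt.smul (hr' y (hsupp hy)).1).contMDiffAt),
    (isCompact_closedBall 0 r).of_isClosed_subset (isClosed_tsupport _) hsupp, fun y => ?_, ?_⟩
  · by_cases hy : y ∈ tsupport fun y => χ y • h y
    · exact (norm_fderiv_smul_le hr (fun z hz => (hr' z hz).1.differentiableAt (by simp))
        (fun z hz => (hr' z hz).2) h0 (hsupp hy) (hχ.differentiable (by simp) y) (hχ1 y)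
        (hχ' y)).trans_eq (mul_div_cancel₀ ε hC1.ne')
    · rw [Function.notMem_support.mp fun hy' => hy (support_fderiv_subset ℝ hy'), norm_zero]
      exact hε.le
  · filter_upwards [hχ0] with y hy
    rw [hy, one_smul]

theorem bijective_id_add_of_norm_fderiv_le [CompleteSpace E] {φ : E → E}
    (hφ : Differentiable ℝ φ) {c : NNReal} (hc : c < 1) (hφc : ∀ y, ‖fderiv ℝ φ y‖₊ ≤ c) :
    Function.Bijective fun y => y + φ y := by
  have hcontr (z : E) : ContractingWith c fun y => z - φ y :=
    ⟨hc, (by simpa using (LipschitzWith.const z).sub (lipschitzWith_of_nnnorm_fderiv_le hφ hφc))⟩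
  have hfix (y z : E) : Function.IsFixedPt (fun y => z - φ y) y ↔ y + φ y = z := by
    rw [Function.IsFixedPt, sub_eq_iff_eq_add, eq_comm]
  refine ⟨fun x y hxy => (hcontr (y + φ y)).fixedPoint_unique' ((hfix _ _).mpr hxy)
    ((hfix _ _).mpr rfl), fun z => ⟨_, (hfix _ z).mp (hcontr z).fixedPoint_isFixedPt⟩⟩

theorem isLocalDiffeomorph_id_add_of_norm_fderiv_lt [CompleteSpace E] {φ : E → E}
    (hφ : ContDiff ℝ ∞ φ) (hφ' : ∀ y, ‖fderiv ℝ φ y‖ < 1) :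
    IsLocalDiffeomorph 𝓘(ℝ, E) 𝓘(ℝ, E) ∞ fun y => y + φ y := by
  intro y
  have hderiv : fderiv ℝ (fun y => y + φ y) y = 1 - -fderiv ℝ φ y := by
    rw [sub_neg_eq_add]
    exact ((hasFDerivAt_id y).add (hφ.differentiable (by simp) y).hasFDerivAt).fderiv
  refine isLocalDiffeomorphAt_of_fderiv_bijective isOpen_univ
    (contDiff_fun_id.add hφ).contDiffOn (by simp) (mem_univ y) ?_
  rw [hderiv, ← ContinuousLinearMap.isUnit_iff_bijective]
  exact isUnit_one_sub_of_norm_lt_one (by rw [norm_neg]; exact hφ' y)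

theorem exists_diffeo_eventuallyEq_of_fderiv_eq_id [HasContDiffBump E] [FiniteDimensional ℝ E]
    {g : E → E} {U : Set E} (hU : U ∈ 𝓝 0) (hg : ContDiffOn ℝ ∞ g U) (hg0 : g 0 = 0)
    (hg' : fderiv ℝ g 0 = ContinuousLinearMap.id ℝ E) :
    ∃ K : E → E, Function.Bijective K ∧ IsLocalDiffeomorph 𝓘(ℝ, E) 𝓘(ℝ, E) ∞ K ∧
      K =ᶠ[𝓝 0] g ∧ ∃ R > 0, ∀ y, R ≤ ‖y‖ → K y = y := by
  have : CompleteSpace E := FiniteDimensional.complete ℝ E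
  have h0' : fderiv ℝ (fun y => g y - y) 0 = 0 := by
    have h := ((hg.contDiffAt hU).differentiableAt (by simp)).hasFDerivAt.sub (hasFDerivAt_id 0)
    exact h.fderiv.trans (by rw [hg', sub_self])
  obtain ⟨φ, hφ, hsupp, hφ', hφg⟩ := exists_contDiff_norm_fderiv_le_eventuallyEq hU
    (hg.sub contDiffOn_id) (by simp [hg0]) h0' (half_pos one_pos)
  obtain ⟨R, hR, hRφ⟩ := hsupp.exists_pos_le_norm
  refine ⟨fun y => y + φ y, bijective_id_add_of_norm_fderiv_le (hφ.differentiable (by simp))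
    (NNReal.half_lt_self one_ne_zero) fun y => NNReal.coe_le_coe.mp (by simpa using hφ' y),
    isLocalDiffeomorph_id_add_of_norm_fderiv_lt hφ fun y => (hφ' y).trans_lt one_half_lt_one, ?_,
    R, hR, fun y hy => by simp only [hRφ y hy, add_zero]⟩
  filter_upwards [hφg] with y hy
  rw [hy, id, add_sub_cancel]

end GermExtension

section RadialMaps

open Filter Topology Metric

section Collar

variable {E : Type*} [NormedAddCommGroup E]

/-- The filter of the points of the open unit ball near the unit sphere. -/
def innerCollar (E : Type*) [NormedAddCommGroup E] : Filter E :=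
  comap norm (𝓝[<] 1)

theorem eventually_norm_mem_innerCollar {a : ℝ} (ha : a < 1) :
    ∀ᶠ x in innerCollar E, ‖x‖ ∈ Ioo a 1 :=
  preimage_mem_comap (Ioo_mem_nhdsLT ha)

theorem exists_of_eventually_innerCollar {p : E → Prop} (h : ∀ᶠ x in innerCollar E, p x) :
    ∃ ρ < 1, ∀ x, ρ < ‖x‖ → ‖x‖ < 1 → p x := by
  obtain ⟨ρ, hρ, h⟩ := ((nhdsLT_basis (1 : ℝ)).comap norm).eventually_iff.mp h
  exact ⟨ρ, hρ, fun x hx hx1 => h ⟨hx, hx1⟩⟩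

variable [NormedSpace ℝ E] {x : E}

/-- The map `t • ω ↦ (1 - t) • ω` (for `0 < t < 1` and `‖ω‖ = 1`), along which two discs are
identified in a connected sum. -/
noncomputable def collarFlip (x : E) : E := ((1 - ‖x‖) / ‖x‖) • x

theorem norm_collarFlip (hx0 : x ≠ 0) (hx : ‖x‖ < 1) : ‖collarFlip x‖ = 1 - ‖x‖ := by
  have hpos : 0 < ‖x‖ := norm_pos_iff.mpr hx0
  rw [collarFlip, norm_smul, Real.norm_of_nonneg (div_pos (sub_pos.mpr hx) hpos).le,
    div_mul_cancel₀ _ hpos.ne']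

theorem collarFlip_ne_zero (hx0 : x ≠ 0) (hx : ‖x‖ < 1) : collarFlip x ≠ 0 :=
  smul_ne_zero (div_pos (sub_pos.mpr hx) (norm_pos_iff.mpr hx0)).ne' hx0

theorem tendsto_collarFlip : Tendsto (collarFlip : E → E) (innerCollar E) (𝓝[≠] 0) := by
  have hmem : ∀ᶠ x in innerCollar E, x ≠ 0 ∧ ‖x‖ < 1 := by
    filter_upwards [eventually_norm_mem_innerCollar one_pos] with x hx
    exact ⟨norm_pos_iff.mp hx.1, hx.2⟩
  refine tendsto_nhdsWithin_iff.mpr ⟨tendsto_zero_iff_norm_tendsto_zero.mpr ?_, ?_⟩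
  · have hnorm : Tendsto norm (innerCollar E) (𝓝 1) := tendsto_comap.mono_right nhdsWithin_le_nhds
    have hlim : Tendsto (fun x : E => 1 - ‖x‖) (innerCollar E) (𝓝 0) := by
      simpa using hnorm.const_sub 1
    exact hlim.congr' (hmem.mono fun x hx => (norm_collarFlip hx.1 hx.2).symm)
  · exact hmem.mono fun x hx => collarFlip_ne_zero hx.1 hx.2

end Collar

section NormedSpace

variable {E : Type*} [NormedAddCommGroup E] [NormedSpace ℝ E] {m : E → ℝ}

theorem isLocalDiffeomorphAt_smul_self [FiniteDimensional ℝ E] {U : Set E} (hU : IsOpen U)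
    (hm : ContDiffOn ℝ ∞ m U) {x : E} (hx : x ∈ U) (hmx : m x ≠ 0)
    (hmx' : m x + fderiv ℝ m x x ≠ 0) :
    IsLocalDiffeomorphAt 𝓘(ℝ, E) 𝓘(ℝ, E) ∞ (fun y => m y • y) x := by
  have : CompleteSpace E := FiniteDimensional.complete ℝ E
  have hderiv (v : E) : fderiv ℝ (fun y => m y • y) x v = m x • v + fderiv ℝ m x v • x := by
    have hmd : DifferentiableAt ℝ m x :=
      (hm.contDiffAt (hU.mem_nhds hx)).differentiableAt (by simp)
    rw [fderiv_fun_smul hmd differentiableAt_fun_id, fderiv_fun_id]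
    rfl
  have hinj : Function.Injective (fderiv ℝ (fun y => m y • y) x) := by
    refine (injective_iff_map_eq_zero _).mpr fun v hv => ?_
    rw [hderiv] at hv
    have hmv : fderiv ℝ m x v = 0 := by
      have h := congrArg (fderiv ℝ m x) hv
      simp only [map_add, map_smul, smul_eq_mul, map_zero] at h
      exact (mul_eq_zero.mp (by linear_combination h)).resolve_right hmx'
    rw [hmv, zero_smul, add_zero] at hv
    exact (smul_eq_zero.mp hv).resolve_left hmx
  exact isLocalDiffeomorphAt_of_fderiv_bijective hU (hm.smul contDiffOn_id) (by simp) hx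
    ⟨hinj, LinearMap.injective_iff_surjective.mp hinj⟩

theorem isLocalDiffeomorphOn_smul_self [FiniteDimensional ℝ E]
    (hm : ContDiffOn ℝ ∞ m (ball 0 1)) (hmpos : ∀ x ∈ ball 0 1, 0 < m x)
    (hm' : ∀ ξ : E, ‖ξ‖ = 1 → ∀ s ∈ Ioo (0 : ℝ) 1, 0 < deriv (fun s => s * m (s • ξ)) s) :
    IsLocalDiffeomorphOn 𝓘(ℝ, E) 𝓘(ℝ, E) ∞ (fun x => m x • x) (ball 0 1) := by
  rintro ⟨x, hx⟩
  refine isLocalDiffeomorphAt_smul_self isOpen_ball hm hx (hmpos x hx).ne' ?_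
  rcases eq_or_ne x 0 with rfl | hx0
  · simpa using (hmpos 0 hx).ne'
  set ξ := ‖x‖⁻¹ • x
  have hxξ : ‖x‖ • ξ = x := smul_inv_smul₀ (norm_ne_zero_iff.mpr hx0) x
  have hmd : HasFDerivAt m (fderiv ℝ m x) (‖x‖ • ξ) := by
    rw [hxξ]
    exact ((hm.contDiffAt (isOpen_ball.mem_nhds hx)).differentiableAt (by simp)).hasFDerivAt
  have hderiv : HasDerivAt (fun s => s * m (s • ξ)) (m x + fderiv ℝ m x x) ‖x‖ := by
    have hline : HasDerivAt (fun s : ℝ => s • ξ) ξ ‖x‖ := by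
      simpa using (hasDerivAt_id ‖x‖).smul_const ξ
    have h := (hasDerivAt_id ‖x‖).mul (hmd.comp_hasDerivAt ‖x‖ hline)
    have hrad : m x + fderiv ℝ m x x = 1 * m (‖x‖ • ξ) + ‖x‖ * fderiv ℝ m x ξ := by
      rw [one_mul, ← smul_eq_mul, ← map_smul, hxξ]
    exact hrad ▸ h
  rw [← hderiv.deriv]
  exact (hm' ξ (norm_smul_inv_norm hx0) _ ⟨norm_pos_iff.mpr hx0, mem_ball_zero_iff.mp hx⟩).ne'

theorem bijOn_smul_self_ball (hm : ∀ x ∈ ball 0 1, 0 < m x)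
    (h : ∀ ξ : E, ‖ξ‖ = 1 → BijOn (fun s => s * m (s • ξ)) (Ioo 0 1) (Ioi 0)) :
    BijOn (fun x => m x • x) (ball 0 1) univ := by
  refine ⟨mapsTo_univ _ _, fun x hx y hy hxy => ?_, fun y _ => ?_⟩
  · replace hxy : m x • x = m y • y := hxy
    rcases eq_or_ne x 0 with rfl | hx0
    · exact ((smul_eq_zero.mp (hxy.symm.trans (smul_zero _))).resolve_left (hm y hy).ne').symm
    have hy0 : y ≠ 0 := by
      rintro rfl
      exact smul_ne_zero (hm x hx).ne' hx0 (hxy.trans (smul_zero _))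
    have hdir : ‖x‖⁻¹ • x = ‖y‖⁻¹ • y := by
      exact (sameRay_iff_inv_norm_smul_eq_of_ne hx0 hy0).mp
        (Or.inr (Or.inr ⟨m x, m y, hm x hx, hm y hy, hxy⟩))
    set ξ := ‖x‖⁻¹ • x
    have hxξ : ‖x‖ • ξ = x := smul_inv_smul₀ (norm_ne_zero_iff.mpr hx0) x
    have hyξ : ‖y‖ • ξ = y := by rw [hdir, smul_inv_smul₀ (norm_ne_zero_iff.mpr hy0)]
    have hnorm : ‖x‖ * m (‖x‖ • ξ) = ‖y‖ * m (‖y‖ • ξ) := by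
      rw [hxξ, hyξ, mul_comm, mul_comm ‖y‖]
      simpa only [norm_smul, Real.norm_of_nonneg (hm x hx).le, Real.norm_of_nonneg (hm y hy).le]
        using congrArg norm hxy
    have hxy' : ‖x‖ = ‖y‖ := (h ξ (norm_smul_inv_norm (𝕜 := ℝ) hx0)).injOn
      ⟨norm_pos_iff.mpr hx0, mem_ball_zero_iff.mp hx⟩
      ⟨norm_pos_iff.mpr hy0, mem_ball_zero_iff.mp hy⟩ hnorm
    rw [← hxξ, ← hyξ, hxy']
  · rcases eq_or_ne y 0 with rfl | hy0
    · exact ⟨0, mem_ball_self one_pos, smul_zero _⟩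
    have hξ : ‖‖y‖⁻¹ • y‖ = 1 := norm_smul_inv_norm (𝕜 := ℝ) hy0
    obtain ⟨s, hs, hsy⟩ := (h _ hξ).surjOn (norm_pos_iff.mpr hy0)
    refine ⟨s • ‖y‖⁻¹ • y, ?_, ?_⟩
    · rw [mem_ball_zero_iff, norm_smul, hξ, Real.norm_of_nonneg hs.1.le, mul_one]
      exact hs.2
    · dsimp only at hsy ⊢
      rw [smul_smul, mul_comm, hsy, smul_inv_smul₀ (norm_ne_zero_iff.mpr hy0)]

end NormedSpace

section RayProfile

variable {c a s : ℝ}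

/-- The radial function along a ray of the map built in `exists_radial_diffeo`: linear with slope
`c` near zero, and tending to infinity like `(a * (1 - s))⁻¹` at one. -/
noncomputable def rayProfile (c a : ℝ) : ℝ → ℝ :=
  interpolate (1 / 4) (1 / 2) (fun s => c * s) fun s => (a * (1 - s))⁻¹

theorem rayProfile_of_le (hs : s ≤ 1 / 4) : rayProfile c a s = c * s :=
  interpolate_of_le (by norm_num) hs

theorem rayProfile_of_ge (hs : 1 / 2 ≤ s) : rayProfile c a s = (a * (1 - s))⁻¹ :=
  interpolate_of_ge (by norm_num) hs

theorem contDiffOn_rayProfile (ha : a ≠ 0) : ContDiffOn ℝ ∞ (rayProfile c a) (Ioo 0 1) :=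
  contDiffOn_interpolate (by fun_prop)
    (ContDiffOn.inv (by fun_prop) fun _ hs => mul_ne_zero ha (sub_pos.mpr hs.2).ne')

theorem deriv_rayProfile_pos (hc : 0 < c) (ha : 0 < a) (hca : c * a ≤ 1) (hs : s ∈ Ioo 0 1) :
    0 < deriv (rayProfile c a) s := by
  have hs1 : 0 < 1 - s := sub_pos.mpr hs.2
  have hf : HasDerivAt (fun s => c * s) c s := by simpa using (hasDerivAt_id s).const_mul c
  have hg : HasDerivAt (fun s => (a * (1 - s))⁻¹) (a / (a * (1 - s)) ^ 2) s := by
    simpa only [mul_neg_one, neg_neg] using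
      (((hasDerivAt_id' s).const_sub 1).const_mul a).fun_inv (mul_pos ha hs1).ne'
  refine deriv_interpolate_pos (by norm_num) hf.differentiableAt hg.differentiableAt
    (by rwa [hf.deriv]) (by rw [hg.deriv]; positivity) fun _ => ?_
  rw [← one_div, le_div_iff₀ (by positivity)]
  have hss : s * (1 - s) ≤ 1 := mul_le_one₀ hs.2.le hs1.le (sub_le_self 1 hs.1.le)
  calc c * s * (a * (1 - s)) = c * a * (s * (1 - s)) := by ring
    _ ≤ 1 := mul_le_one₀ hca (mul_pos hs.1 hs1).le hss

theorem bijOn_rayProfile (hc : 0 < c) (ha : 0 < a) (hca : c * a ≤ 1) :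
    BijOn (rayProfile c a) (Ioo 0 1) (Ioi 0) := by
  have hcont := (contDiffOn_rayProfile (c := c) ha.ne').continuousOn
  have hmono : StrictMonoOn (rayProfile c a) (Ioo 0 1) :=
    strictMonoOn_of_deriv_pos (convex_Ioo 0 1) hcont fun s hs =>
      deriv_rayProfile_pos hc ha hca (interior_subset hs)
  refine ⟨fun s hs => ?_, hmono.injOn, ?_⟩
  · have hs1 : 0 < 1 - s := sub_pos.mpr hs.2
    exact interpolate_mem (convex_Ioi 0) (mul_pos hc hs.1) (inv_pos.mpr (mul_pos ha hs1))
  have hzero : Tendsto (rayProfile c a) (𝓝[>] 0) (𝓝 0) := by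
    have hlin : Tendsto (fun s => c * s) (𝓝[>] 0) (𝓝 0) := by
      simpa using ((continuous_const_mul c).tendsto 0).mono_left nhdsWithin_le_nhds
    refine hlin.congr' ?_
    filter_upwards [Ioo_mem_nhdsGT (show (0 : ℝ) < 1 / 4 by norm_num)] with s hs
    exact (rayProfile_of_le hs.2.le).symm
  have hone : Tendsto (rayProfile c a) (𝓝[<] 1) atTop := by
    have hinv : Tendsto (fun s => (a * (1 - s))⁻¹) (𝓝[<] 1) atTop := by
      refine tendsto_inv_nhdsGT_zero.comp (tendsto_nhdsWithin_iff.mpr ⟨?_, ?_⟩)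
      · have h : Continuous fun s : ℝ => a * (1 - s) := by fun_prop
        simpa using (h.tendsto 1).mono_left nhdsWithin_le_nhds
      · filter_upwards [self_mem_nhdsWithin] with s hs using mul_pos ha (sub_pos.mpr hs)
    refine hinv.congr' ?_
    filter_upwards [Ioo_mem_nhdsLT (show (1 / 2 : ℝ) < 1 by norm_num)] with s hs
    exact (rayProfile_of_ge hs.1.le).symm
  exact isPreconnected_Ioo.intermediate_value_Ioi
    (le_principal_iff.mpr (Ioo_mem_nhdsGT one_pos))
    (le_principal_iff.mpr (Ioo_mem_nhdsLT one_pos)) hcont hzero hone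

end RayProfile

section InnerProductSpace

variable {E F : Type*} [NormedAddCommGroup E] [InnerProductSpace ℝ E] [NormedAddCommGroup F]
  [InnerProductSpace ℝ F] (A : E →L[ℝ] F) {ξ x : E} {s : ℝ}

/-- The factor `m` for which `x ↦ m x • x` stretches the unit ball onto the whole space, by a
constant near the origin and so that `A (m x • x)` is the inversion of `A (collarFlip x)` near the
unit sphere. The constant is small enough for the map to increase along rays. -/
noncomputable def radialFactor (x : E) : ℝ :=
  interpolate (1 / 4) (1 / 2) (fun _ => (‖A‖ ^ 2 + 1)⁻¹) (fun s => s / ((1 - s) * ‖A x‖ ^ 2)) ‖x‖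

theorem mul_radialFactor_smul (hξ : ‖ξ‖ = 1) (hs : 0 < s) :
    s * radialFactor A (s • ξ) = rayProfile (‖A‖ ^ 2 + 1)⁻¹ (‖A ξ‖ ^ 2) s := by
  have hnorm : ‖s • ξ‖ = s := by rw [norm_smul, hξ, mul_one, Real.norm_of_nonneg hs.le]
  have hA : ‖A (s • ξ)‖ ^ 2 = s ^ 2 * ‖A ξ‖ ^ 2 := by
    rw [map_smul, norm_smul, Real.norm_of_nonneg hs.le, mul_pow]
  rw [radialFactor, rayProfile, interpolate, interpolate, hnorm, hA, mul_inv]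
  field_simp

theorem inv_opNorm_sq_mul_le_one (hξ : ‖ξ‖ = 1) : (‖A‖ ^ 2 + 1)⁻¹ * ‖A ξ‖ ^ 2 ≤ 1 := by
  rw [inv_mul_le_one₀ (by positivity)]
  have hle : ‖A ξ‖ ≤ ‖A‖ := by simpa [hξ] using A.le_opNorm ξ
  exact (pow_le_pow_left₀ (norm_nonneg _) hle 2).trans (le_add_of_nonneg_right zero_le_one)

variable {A}

theorem radialFactor_pos (hA : Function.Injective A) (hx : ‖x‖ < 1) : 0 < radialFactor A x := by
  have hc : 0 < (‖A‖ ^ 2 + 1)⁻¹ := by positivity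
  rcases eq_or_ne x 0 with rfl | hx0
  · rwa [radialFactor, interpolate_of_le (by norm_num) (by norm_num)]
  have hAx : 0 < ‖A x‖ := norm_pos_iff.mpr ((map_ne_zero_iff A hA).mpr hx0)
  exact interpolate_mem (convex_Ioi 0) hc
    (div_pos (norm_pos_iff.mpr hx0) (mul_pos (sub_pos.mpr hx) (pow_pos hAx 2)))

theorem contDiffOn_radialFactor (hA : Function.Injective A) :
    ContDiffOn ℝ ∞ (radialFactor A) (ball 0 1) := by
  refine fun x hx => ContDiffAt.contDiffWithinAt ?_
  rcases eq_or_ne x 0 with rfl | hx0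
  · refine (contDiffAt_const (c := (‖A‖ ^ 2 + 1)⁻¹)).congr_of_eventuallyEq ?_
    filter_upwards [ball_mem_nhds (0 : E) (show (0 : ℝ) < 1 / 4 by norm_num)] with y hy
    exact interpolate_of_le (by norm_num) (mem_ball_zero_iff.mp hy).le
  have hnorm : ContDiffAt ℝ ∞ (fun x : E => ‖x‖) x := contDiffAt_norm ℝ hx0
  have hη := contDiff_smoothStep (a := 1 / 4) (b := 1 / 2) |>.contDiffAt.comp x hnorm
  have hAx : ‖A x‖ ^ 2 ≠ 0 := by simpa using (map_ne_zero_iff A hA).mpr hx0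
  refine ((contDiffAt_const.sub hη).mul contDiffAt_const).add (hη.mul (hnorm.div ?_ ?_))
  · exact (contDiffAt_const.sub hnorm).mul ((contDiff_norm_sq ℝ).comp A.contDiff).contDiffAt
  · exact mul_ne_zero (sub_pos.mpr (mem_ball_zero_iff.mp hx)).ne' hAx

theorem map_radialFactor_smul (hx : 1 / 2 ≤ ‖x‖) (hx1 : ‖x‖ < 1) :
    A (radialFactor A x • x) =
      EuclideanGeometry.inversion 0 1 (A (collarFlip x)) := by
  have hx0 : 0 < ‖x‖ := by linarith
  rw [collarFlip, radialFactor, interpolate_of_ge (by norm_num) hx, EuclideanGeometry.inversion]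
  simp only [dist_zero_right, vsub_eq_sub, sub_zero, vadd_eq_add, add_zero, map_smul, norm_smul,
    smul_smul, Real.norm_of_nonneg (div_nonneg (sub_pos.mpr hx1).le hx0.le)]
  congr 1
  have h1 : 1 - ‖x‖ ≠ 0 := (sub_pos.mpr hx1).ne'
  field_simp

theorem exists_radial_diffeo [FiniteDimensional ℝ E] (hA : Function.Injective A) :
    ∃ R : E → E, BijOn R (ball 0 1) univ ∧
      IsLocalDiffeomorphOn 𝓘(ℝ, E) 𝓘(ℝ, E) ∞ R (ball 0 1) ∧
      ∀ᶠ x in innerCollar E, A (R x) = EuclideanGeometry.inversion 0 1 (A (collarFlip x)) := by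
  have hpos (x : E) (hx : x ∈ ball 0 1) : 0 < radialFactor A x :=
    radialFactor_pos hA (mem_ball_zero_iff.mp hx)
  have hAξ (ξ : E) (hξ : ‖ξ‖ = 1) : 0 < ‖A ξ‖ ^ 2 := by
    have : A ξ ≠ 0 := (map_ne_zero_iff A hA).mpr (norm_ne_zero_iff.mp (hξ ▸ one_ne_zero))
    positivity
  have hc : 0 < (‖A‖ ^ 2 + 1)⁻¹ := by positivity
  refine ⟨fun x => radialFactor A x • x, bijOn_smul_self_ball hpos fun ξ hξ => ?_,
    isLocalDiffeomorphOn_smul_self (contDiffOn_radialFactor hA) hpos fun ξ hξ s hs => ?_,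
    (eventually_norm_mem_innerCollar (show (1 / 2 : ℝ) < 1 by norm_num)).mono
      fun x hx => map_radialFactor_smul hx.1.le hx.2⟩
  · exact (bijOn_rayProfile hc (hAξ ξ hξ) (inv_opNorm_sq_mul_le_one A hξ)).congr fun s hs =>
      (mul_radialFactor_smul A hξ hs.1).symm
  · have heq : (fun s => s * radialFactor A (s • ξ)) =ᶠ[𝓝 s] _ :=
      eventually_of_mem (Ioi_mem_nhds hs.1) fun s hs => mul_radialFactor_smul A hξ hs
    rw [heq.deriv_eq]
    exact deriv_rayProfile_pos hc (hAξ ξ hξ) (inv_opNorm_sq_mul_le_one A hξ) hs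

end InnerProductSpace

end RadialMaps

section Inversion

open EuclideanGeometry Filter Topology Metric

variable {E F : Type*} [NormedAddCommGroup E] [InnerProductSpace ℝ E] [NormedAddCommGroup F]
  [InnerProductSpace ℝ F]

theorem linearIsometry_inversion_zero (L : E →ₗᵢ[ℝ] F) (R : ℝ) (x : E) :
    L (inversion 0 R x) = inversion 0 R (L x) := by
  simp [inversion]

theorem isLocalDiffeomorphAt_inversion {c x : E} {R : ℝ} (hR : R ≠ 0) (hx : x ≠ c) :
    IsLocalDiffeomorphAt 𝓘(ℝ, E) 𝓘(ℝ, E) ∞ (inversion c R) x := by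
  have hsmooth : ContDiffOn ℝ ∞ (inversion c R) {c}ᶜ :=
    contDiffOn_const.inversion contDiffOn_const contDiffOn_id fun _ hy => hy
  have hmaps : MapsTo (inversion c R) {c}ᶜ {c}ᶜ := fun _ hy => (inversion_eq_center hR).not.mpr hy
  let e : OpenPartialHomeomorph E E :=
    { toFun := inversion c R
      invFun := inversion c R
      source := {c}ᶜ
      target := {c}ᶜ
      map_source' := hmaps
      map_target' := hmaps
      left_inv' := fun y _ => inversion_involutive c hR y
      right_inv' := fun y _ => inversion_involutive c hR y
      open_source := isOpen_compl_singleton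
      open_target := isOpen_compl_singleton
      continuousOn_toFun := hsmooth.continuousOn
      continuousOn_invFun := hsmooth.continuousOn }
  exact isLocalDiffeomorphAt_of_contMDiffOn_symm e hsmooth.contMDiffOn hsmooth.contMDiffOn hx

theorem isLocalDiffeomorph_inversion_conj {K : E → E} (hK : Function.Injective K)
    (hKd : IsLocalDiffeomorph 𝓘(ℝ, E) 𝓘(ℝ, E) ∞ K) (hK0 : K 0 = 0) {R : ℝ} (hR : 0 < R)
    (hKR : ∀ y, R ≤ ‖y‖ → K y = y) :
    IsLocalDiffeomorph 𝓘(ℝ, E) 𝓘(ℝ, E) ∞ (inversion 0 1 ∘ K ∘ inversion 0 1) := by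
  intro y
  rcases eq_or_ne y 0 with rfl | hy
  · refine isLocalDiffeomorphAt_congr
      ((Diffeomorph.refl 𝓘(ℝ, E) E ∞).isLocalDiffeomorph 0) ?_
    filter_upwards [ball_mem_nhds (0 : E) (inv_pos.mpr hR)] with y hy
    have hKy : K (inversion 0 1 y) = inversion 0 1 y := by
      rcases eq_or_ne y 0 with rfl | hy0
      · rw [inversion_self, hK0]
      refine hKR _ ?_
      rw [← dist_zero_right, dist_inversion_center, one_pow, dist_zero_right, one_div,
        le_inv_comm₀ hR (norm_pos_iff.mpr hy0)]
      exact (mem_ball_zero_iff.mp hy).le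
    exact (congrArg _ hKy).trans (inversion_involutive 0 one_ne_zero y)
  · have hinv : inversion 0 1 y ≠ 0 := (inversion_eq_center one_ne_zero).not.mpr hy
    have hKinv : K (inversion 0 1 y) ≠ 0 := fun h => hinv (hK (h.trans hK0.symm))
    exact ((isLocalDiffeomorphAt_inversion one_ne_zero hy).comp _ _ (hKd _)).comp _ _
      (isLocalDiffeomorphAt_inversion one_ne_zero hKinv)

theorem exists_diffeo_eventuallyEq_comp_symm [FiniteDimensional ℝ E] {κ : E → E}
    (hκ : IsLocalDiffeomorphAt 𝓘(ℝ, E) 𝓘(ℝ, E) ∞ κ 0) (hκ0 : κ 0 = 0) :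
    ∃ (A : E ≃L[ℝ] E) (K : E → E), Function.Bijective K ∧
      IsLocalDiffeomorph 𝓘(ℝ, E) 𝓘(ℝ, E) ∞ K ∧ K =ᶠ[𝓝 0] κ ∘ A.symm ∧
      ∃ R > 0, ∀ y, R ≤ ‖y‖ → K y = y := by
  let A : E ≃L[ℝ] E := hκ.mfderivToContinuousLinearEquiv (by simp)
  have hA : HasFDerivAt κ (A : E →L[ℝ] E) (A.symm 0) := by
    have hdiff : DifferentiableAt ℝ κ 0 := (hκ.mdifferentiableAt (by simp)).differentiableAt
    have hfderiv : fderiv ℝ κ 0 = A := mfderiv_eq_fderiv.symm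
    rw [map_zero, ← hfderiv]
    exact hdiff.hasFDerivAt
  have hderiv : fderiv ℝ (κ ∘ A.symm) 0 = ContinuousLinearMap.id ℝ E := by
    rw [(hA.comp 0 A.symm.hasFDerivAt).fderiv]
    exact A.coe_comp_coe_symm
  obtain ⟨Φ, hΦ0, hΦ⟩ := hκ
  have hU : A.symm ⁻¹' Φ.source ∈ 𝓝 0 :=
    (Φ.open_source.preimage A.symm.continuous).mem_nhds (by simpa using hΦ0)
  have hsmooth : ContDiffOn ℝ ∞ (κ ∘ A.symm) (A.symm ⁻¹' Φ.source) :=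
    (Φ.contMDiffOn_toFun.congr hΦ).contDiffOn.comp A.symm.contDiff.contDiffOn fun _ h => h
  exact ⟨A, exists_diffeo_eventuallyEq_of_fderiv_eq_id hU hsmooth (by simp [hκ0]) hderiv⟩

/-- The linear part `A` of `κ` is split off and absorbed by a radial map, since only a germ which is
tangent to the identity extends to a diffeomorphism equal to the identity near infinity, whose
conjugate by the inversion is then smooth at the origin. -/
theorem exists_diffeo_ball_eventuallyEq_inversion [FiniteDimensional ℝ E] {κ : E → E}
    (hκ : IsLocalDiffeomorphAt 𝓘(ℝ, E) 𝓘(ℝ, E) ∞ κ 0) (hκ0 : κ 0 = 0) :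
    ∃ D : E → E, BijOn D (ball 0 1) univ ∧
      IsLocalDiffeomorphOn 𝓘(ℝ, E) 𝓘(ℝ, E) ∞ D (ball 0 1) ∧
      D =ᶠ[innerCollar E] inversion 0 1 ∘ κ ∘ collarFlip := by
  obtain ⟨A, K, hK, hKd, hKκ, r, hr, hKr⟩ := exists_diffeo_eventuallyEq_comp_symm hκ hκ0
  obtain ⟨R, hR, hRd, hAR⟩ := exists_radial_diffeo (A := (A : E →L[ℝ] E)) A.injective
  have hK0 : K 0 = 0 := by simp [hKκ.self_of_nhds, hκ0]
  have hinv : Function.Bijective (inversion (0 : E) 1) := inversion_bijective 0 one_ne_zero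
  refine ⟨(inversion 0 1 ∘ K ∘ inversion 0 1) ∘ A ∘ R, ?_, fun x => ?_, ?_⟩
  · exact (bijOn_univ.mpr ((hinv.comp (hK.comp hinv)).comp A.bijective)).comp hR
  · exact ((hRd x).comp _ _ (A.toDiffeomorph.isLocalDiffeomorph _)).comp _ _
      (isLocalDiffeomorph_inversion_conj hK.1 hKd hK0 hr hKr _)
  · have hlim : Tendsto (A ∘ collarFlip) (innerCollar E) (𝓝 0) := by
      simpa using (A.continuous.tendsto 0).comp (tendsto_collarFlip.mono_right nhdsWithin_le_nhds)
    filter_upwards [hAR, hlim.eventually hKκ] with x hx hKx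
    have hKA : K (A (collarFlip x)) = κ (collarFlip x) := by simpa using hKx
    simp only [Function.comp_apply]
    rw [← hKA, ← inversion_involutive (0 : E) one_ne_zero (A (collarFlip x))]
    exact congrArg (fun y => inversion 0 1 (K (inversion 0 1 y))) hx

end Inversion

section Stereographic

open EuclideanGeometry Filter Topology Metric

variable {E : Type*} [NormedAddCommGroup E] [InnerProductSpace ℝ E]

theorem coe_stereographic {v : E} (hv : ‖v‖ = 1) (x : sphere (0 : E) 1) :
    (stereographic hv x : E) =
      (2 / (1 - inner ℝ v x)) • ((x : E) - inner ℝ v (x : E) • v) := by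
  rw [stereographic_apply, Submodule.coe_smul, ← Submodule.starProjection_apply,
    Submodule.starProjection_orthogonal_val, Submodule.starProjection_unit_singleton ℝ hv]

theorem inner_lt_one_of_mem_sphere {v x : sphere (0 : E) 1} (h : x ≠ v) :
    inner ℝ (v : E) x < 1 :=
  (inner_lt_one_iff_real_of_norm_eq_one (norm_eq_of_mem_sphere v) (norm_eq_of_mem_sphere x)).mpr
    fun hvx => h (Subtype.ext hvx.symm)

theorem coe_stereographic_eq_inversion {v x : sphere (0 : E) 1} (hv : x ≠ v) (hv' : x ≠ -v) :
    (stereographic (norm_eq_of_mem_sphere v) x : E) =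
      (4 : ℝ) • inversion 0 1 (stereographic (norm_eq_of_mem_sphere (-v)) x : E) := by
  set a : ℝ := inner ℝ (v : E) x with ha
  have hneg : inner ℝ ((-v : sphere (0 : E) 1) : E) (x : E) = -a := by
    rw [coe_neg_sphere, inner_neg_left]
  have hsub : 1 - a ≠ 0 := (sub_pos.mpr (inner_lt_one_of_mem_sphere hv)).ne'
  have hadd : 1 + a ≠ 0 := by
    have := inner_lt_one_of_mem_sphere hv'
    rw [hneg] at this
    linarith
  have hnorm : ‖(x : E) - a • (v : E)‖ ^ 2 = (1 - a) * (1 + a) := by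
    rw [norm_sub_sq_real, norm_smul, inner_smul_right, real_inner_comm, ← ha,
      norm_eq_of_mem_sphere x, norm_eq_of_mem_sphere v, Real.norm_eq_abs, mul_one, sq_abs]
    ring
  rw [coe_stereographic, coe_stereographic, hneg, ← ha, coe_neg_sphere, neg_smul_neg,
    sub_neg_eq_add, inversion, vsub_eq_sub, sub_zero, dist_zero_right, norm_smul, div_pow, mul_pow,
    hnorm, vadd_eq_add, add_zero, Real.norm_eq_abs, sq_abs, smul_smul, smul_smul]
  congr 1
  field_simp
  norm_num

variable {n : ℕ} [Fact (Module.finrank ℝ E = n + 1)]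

theorem stereographic'_eq_repr_stereographic (v x : sphere (0 : E) 1) :
    stereographic' n v x = (OrthonormalBasis.fromOrthogonalSpanSingleton (𝕜 := ℝ) n
      (ne_zero_of_mem_unit_sphere v)).repr (stereographic (norm_eq_of_mem_sphere v) x) :=
  rfl

theorem stereographic'_neg_apply (v : sphere (0 : E) 1) : stereographic' n (-v) v = 0 := by
  rw [stereographic'_eq_repr_stereographic]
  exact (congrArg _ (stereographic_neg_apply v)).trans (map_zero _)

theorem coe_ofEq_inversion_zero {V W : Submodule ℝ E} (h : V = W) (R : ℝ) (x : V) :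
    (LinearIsometryEquiv.ofEq V W h (inversion 0 R x) : E) = inversion 0 R (x : E) := by
  rw [LinearIsometryEquiv.coe_ofEq_apply]
  exact linearIsometry_inversion_zero V.subtypeₗᵢ R x

theorem exists_stereographic'_eq_inversion (v : sphere (0 : E) 1) :
    ∃ O : Euc n ≃ₗᵢ[ℝ] Euc n, ∀ x, x ≠ v → x ≠ -v →
      stereographic' n v x = (4 : ℝ) • O (inversion 0 1 (stereographic' n (-v) x)) := by
  let T := LinearIsometryEquiv.ofEq (Submodule.span ℝ {((-v : sphere (0 : E) 1) : E)})ᗮ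
    (Submodule.span ℝ {(v : E)})ᗮ (by rw [coe_neg_sphere, ← Set.neg_singleton, Submodule.span_neg])
  have hT (x : sphere (0 : E) 1) (hv : x ≠ v) (hv' : x ≠ -v) :
      stereographic (norm_eq_of_mem_sphere v) x =
        (4 : ℝ) • T (inversion 0 1 (stereographic (norm_eq_of_mem_sphere (-v)) x)) :=
    Subtype.ext <| by
      rw [coe_stereographic_eq_inversion hv hv', Submodule.coe_smul, coe_ofEq_inversion_zero]
  refine ⟨(OrthonormalBasis.fromOrthogonalSpanSingleton (𝕜 := ℝ) n
    (ne_zero_of_mem_unit_sphere (-v))).repr.symm.trans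
      (T.trans (OrthonormalBasis.fromOrthogonalSpanSingleton (𝕜 := ℝ) n
        (ne_zero_of_mem_unit_sphere v)).repr), fun x hv hv' => ?_⟩
  rw [stereographic'_eq_repr_stereographic, stereographic'_eq_repr_stereographic, hT x hv hv',
    map_smul, LinearIsometryEquiv.trans_apply, LinearIsometryEquiv.trans_apply,
    ← LinearIsometryEquiv.coe_toLinearIsometry (OrthonormalBasis.repr _).symm,
    linearIsometry_inversion_zero, LinearIsometryEquiv.coe_toLinearIsometry,
    LinearIsometryEquiv.symm_apply_apply]

end Stereographic

section ComplementaryDisc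

open EuclideanGeometry Filter Topology Metric

variable {n : ℕ}

/-- The complement of the centre of the disc `i`, parametrized by the open unit ball so that near
the unit sphere it is identified with `i` as in a connected sum. -/
structure IsComplementaryDisc {M : Type*} [TopologicalSpace M] [ChartedSpace (Euc n) M]
    (i c : Euc n → M) : Prop where
  bijOn : BijOn c (ball 0 1) {i 0}ᶜ
  isLocalDiffeomorphOn : IsLocalDiffeomorphOn (𝓡 n) (𝓡 n) ∞ c (ball 0 1)
  eventuallyEq : c =ᶠ[innerCollar (Euc n)] i ∘ collarFlip

section Sphere

variable {E : Type*} [NormedAddCommGroup E] [InnerProductSpace ℝ E]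
  [Fact (Module.finrank ℝ E = n + 1)]

theorem stereographic'_mem_maximalAtlas (p : sphere (0 : E) 1) :
    stereographic' n p ∈ IsManifold.maximalAtlas (𝓡 n) ∞ (sphere (0 : E) 1) :=
  IsManifold.subset_maximalAtlas ⟨p, rfl⟩

theorem exists_diffeo_compl_singleton (p : sphere (0 : E) 1) :
    ∃ e : Euc n → sphere (0 : E) 1, BijOn e univ {p}ᶜ ∧ IsLocalDiffeomorph (𝓡 n) (𝓡 n) ∞ e ∧
      ∀ x, x ≠ p → x ≠ -p → e (inversion 0 1 (stereographic' n (-p) x)) = x := by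
  obtain ⟨O, hO⟩ := exists_stereographic'_eq_inversion (n := n) p
  let L : Euc n ≃L[ℝ] Euc n :=
    O.toContinuousLinearEquiv.trans (ContinuousLinearEquiv.smulLeft (Units.mk0 (4 : ℝ) (by simp)))
  have htarget (y : Euc n) : y ∈ (stereographic' n p).target := by simp
  refine ⟨(stereographic' n p).symm ∘ L, ?_, fun y => ?_, fun x hx hx' => ?_⟩
  · have hbij := (stereographic' n p).symm.bijOn
    rw [OpenPartialHomeomorph.symm_source, OpenPartialHomeomorph.symm_target,
      stereographic'_target, stereographic'_source] at hbij
    exact hbij.comp (bijOn_univ.mpr L.bijective)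
  · exact (L.toDiffeomorph.isLocalDiffeomorph y).comp _ _
      (isLocalDiffeomorphAt_symm_of_mem_maximalAtlas (stereographic'_mem_maximalAtlas p)
        (htarget _))
  · have hL : L (inversion 0 1 (stereographic' n (-p) x)) = stereographic' n p x :=
      (hO x hx hx').symm
    rw [Function.comp_apply, hL]
    exact (stereographic' n p).left_inv (by simpa using hx)

theorem IsDisc.exists_isComplementaryDisc_sphere {i : Euc n → sphere (0 : E) 1} (hi : IsDisc i) :
    ∃ c, IsComplementaryDisc i c := by
  obtain ⟨e, he, hed, hei⟩ := exists_diffeo_compl_singleton (n := n) (i 0)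
  have hne : i 0 ≠ -i 0 := ne_neg_of_mem_unit_sphere ℝ (i 0)
  have hκ : IsLocalDiffeomorphAt (𝓡 n) (𝓡 n) ∞ (stereographic' n (-i 0) ∘ i) 0 :=
    (hi.1 0).comp _ _ <| isLocalDiffeomorphAt_of_mem_maximalAtlas
      (stereographic'_mem_maximalAtlas (-i 0)) (by simpa using hne)
  obtain ⟨D, hD, hDd, hDκ⟩ :=
    exists_diffeo_ball_eventuallyEq_inversion hκ (stereographic'_neg_apply (i 0))
  refine ⟨e ∘ D, he.comp hD, fun x => (hDd x).comp _ _ (hed _), ?_⟩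
  have hi' : ∀ᶠ y in 𝓝[≠] 0, e (inversion 0 1 (stereographic' n (-i 0) (i y))) = i y := by
    filter_upwards [nhdsWithin_le_nhds (hi.continuous.continuousAt.eventually_ne hne),
      self_mem_nhdsWithin] with y hy hy0
    exact hei _ (hi.2.ne hy0) hy
  filter_upwards [hDκ, tendsto_collarFlip.eventually hi'] with x hx hx'
  rw [Function.comp_apply, hx]
  exact hx'

end Sphere

section Transport

variable {M M' : Type*} [TopologicalSpace M] [ChartedSpace (Euc n) M] [TopologicalSpace M']
  [ChartedSpace (Euc n) M'] {i : Euc n → M}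

theorem IsDisc.diffeomorph_comp (hi : IsDisc i) (Φ : M ≃ₘ^∞⟮𝓡 n, 𝓡 n⟯ M') : IsDisc (Φ ∘ i) :=
  ⟨fun x => (hi.1 x).comp _ _ (Φ.isLocalDiffeomorph _), Φ.injective.comp hi.2⟩

theorem IsComplementaryDisc.of_diffeomorph_comp (Φ : M ≃ₘ^∞⟮𝓡 n, 𝓡 n⟯ M') {c : Euc n → M'}
    (h : IsComplementaryDisc (Φ ∘ i) c) : IsComplementaryDisc i (Φ.symm ∘ c) where
  bijOn := by
    have hΦ : BijOn Φ.symm {Φ (i 0)}ᶜ {i 0}ᶜ := by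
      simpa using (bijOn_singleton.mpr (Φ.symm_apply_apply (i 0))).compl Φ.symm.bijective
    exact hΦ.comp h.bijOn
  isLocalDiffeomorphOn := fun x =>
    (h.isLocalDiffeomorphOn x).comp _ _ (Φ.symm.isLocalDiffeomorph _)
  eventuallyEq := by
    filter_upwards [h.eventuallyEq] with x hx
    rw [Function.comp_apply, hx]
    exact Φ.symm_apply_apply _

end Transport

theorem IsDisc.exists_isComplementaryDisc {M : Type*} [TopologicalSpace M]
    [ChartedSpace (Euc n) M] {E : Type*} [NormedAddCommGroup E] [InnerProductSpace ℝ E]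
    [Fact (Module.finrank ℝ E = n + 1)] {i : Euc n → M} (hi : IsDisc i)
    (Φ : M ≃ₘ^∞⟮𝓡 n, 𝓡 n⟯ sphere (0 : E) 1) : ∃ c, IsComplementaryDisc i c :=
  let ⟨_, hc⟩ := (hi.diffeomorph_comp Φ).exists_isComplementaryDisc_sphere
  ⟨_, hc.of_diffeomorph_comp Φ⟩

end ComplementaryDisc

section SphereSummand

open Filter Topology Metric

variable {n : ℕ} {M₁ M₂ M : Type*}

theorem glued_collarFlip {i₁ : Euc n → M₁} {i₂ : Euc n → M₂} {x : Euc n} (hx0 : x ≠ 0)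
    (hx : ‖x‖ < 1) : Glued i₁ i₂ (i₁ x) (i₂ (collarFlip x)) := by
  have hx' : ‖x‖ ≠ 0 := norm_ne_zero_iff.mpr hx0
  refine ⟨‖x‖⁻¹ • x, norm_smul_inv_norm hx0, ‖x‖, ⟨norm_pos_iff.mpr hx0, hx⟩, ?_, ?_⟩
  · rw [smul_inv_smul₀ hx']
  · rw [collarFlip, smul_smul, div_eq_mul_inv]

/-- The map that is `f` off the open disc `i`, and on that disc is `g` read in the parametrization
`i`. It is meant for injective `i`. -/
noncomputable def discReplacement (i : Euc n → M₁) (g : Euc n → M) (f : M₁ → M) : M₁ → M :=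
  Function.extend ((ball 0 1).domRestrict i) ((ball 0 1).domRestrict g) f

section DiscReplacement

variable {i : Euc n → M₁} {g : Euc n → M} {f : M₁ → M}

theorem discReplacement_apply_disc (hi : Function.Injective i) {x : Euc n} (hx : x ∈ ball 0 1) :
    discReplacement i g f (i x) = g x :=
  hi.injOn.injective.extend_apply ((ball 0 1).domRestrict g) f ⟨x, hx⟩

theorem discReplacement_apply_compl {y : M₁} (hy : y ∉ i '' ball 0 1) :
    discReplacement i g f y = f y :=
  Function.extend_apply' _ _ _ fun ⟨x, hx⟩ => hy ⟨x, x.2, hx⟩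

theorem discReplacement_injective (hi : Function.Injective i) (hg : InjOn g (ball 0 1))
    (hf : InjOn f (i '' ball 0 1)ᶜ) (hfg : ∀ x ∈ ball 0 1, ∀ y ∉ i '' ball 0 1, g x ≠ f y) :
    Function.Injective (discReplacement i g f) := by
  intro y z hyz
  by_cases hy : y ∈ i '' ball 0 1 <;> by_cases hz : z ∈ i '' ball 0 1
  · obtain ⟨x, hx, rfl⟩ := hy
    obtain ⟨w, hw, rfl⟩ := hz
    rw [discReplacement_apply_disc hi hx, discReplacement_apply_disc hi hw] at hyz
    rw [hg hx hw hyz]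
  · obtain ⟨x, hx, rfl⟩ := hy
    rw [discReplacement_apply_disc hi hx, discReplacement_apply_compl hz] at hyz
    exact (hfg x hx z hz hyz).elim
  · obtain ⟨w, hw, rfl⟩ := hz
    rw [discReplacement_apply_compl hy, discReplacement_apply_disc hi hw] at hyz
    exact (hfg w hw y hy hyz.symm).elim
  · rw [discReplacement_apply_compl hy, discReplacement_apply_compl hz] at hyz
    exact hf hy hz hyz

theorem range_discReplacement (hi : Function.Injective i) :
    range (discReplacement i g f) = g '' ball 0 1 ∪ f '' (i '' ball 0 1)ᶜ := by
  rw [← image_univ, ← union_compl_self (i '' ball 0 1), image_union, image_image]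
  exact congrArg₂ _ (image_congr fun x hx => discReplacement_apply_disc hi hx)
    (image_congr fun y hy => discReplacement_apply_compl hy)

variable [TopologicalSpace M₁] [ChartedSpace (Euc n) M₁]

theorem discReplacement_eventuallyEq [T2Space M₁] (hi : IsDisc i)
    (hfg : g =ᶠ[innerCollar (Euc n)] f ∘ i) {y : M₁} (hy : y ∉ i '' ball 0 1) :
    discReplacement i g f =ᶠ[𝓝 y] f := by
  obtain ⟨ρ, hρ, hρg⟩ := exists_of_eventually_innerCollar hfg
  have hclosed : IsClosed (i '' closedBall 0 ρ) :=
    ((isCompact_closedBall _ _).image hi.continuous).isClosed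
  have hyρ : y ∉ i '' closedBall 0 ρ := fun h =>
    hy (image_mono (closedBall_subset_ball hρ) h)
  filter_upwards [hclosed.isOpen_compl.mem_nhds hyρ] with z hz
  by_cases hz' : z ∈ i '' ball 0 1
  · obtain ⟨x, hx, rfl⟩ := hz'
    have hxρ : ρ < ‖x‖ := not_le.mp fun h => hz ⟨x, mem_closedBall_zero_iff.mpr h, rfl⟩
    rw [discReplacement_apply_disc hi.2 hx]
    exact hρg x hxρ (mem_ball_zero_iff.mp hx)
  · exact discReplacement_apply_compl hz'

variable [TopologicalSpace M] [ChartedSpace (Euc n) M]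

theorem isLocalDiffeomorph_discReplacement [T2Space M₁] (hi : IsDisc i)
    (hg : IsLocalDiffeomorphOn (𝓡 n) (𝓡 n) ∞ g (ball 0 1))
    (hf : IsLocalDiffeomorphOn (𝓡 n) (𝓡 n) ∞ f (i '' ball 0 1)ᶜ)
    (hfg : g =ᶠ[innerCollar (Euc n)] f ∘ i) :
    IsLocalDiffeomorph (𝓡 n) (𝓡 n) ∞ (discReplacement i g f) := by
  intro y
  by_cases hy : y ∈ i '' ball 0 1
  · obtain ⟨x, hx, rfl⟩ := hy
    refine isLocalDiffeomorphAt_of_comp_right (hg ⟨x, hx⟩) (hi.1 x) ?_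
    filter_upwards [isOpen_ball.mem_nhds hx] with z hz
    exact discReplacement_apply_disc hi.2 hz
  · exact isLocalDiffeomorphAt_congr (hf ⟨y, hy⟩) (discReplacement_eventuallyEq hi hfg hy)

end DiscReplacement

variable [TopologicalSpace M₁] [ChartedSpace (Euc n) M₁] [TopologicalSpace M₂]
  [ChartedSpace (Euc n) M₂] [TopologicalSpace M] [ChartedSpace (Euc n) M]

theorem IsConnectedSum.nonempty_diffeomorph [T2Space M₁] (h : IsConnectedSum n M₁ M₂ M)
    {E : Type*} [NormedAddCommGroup E] [InnerProductSpace ℝ E]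
    [Fact (Module.finrank ℝ E = n + 1)] (Φ : M₂ ≃ₘ^∞⟮𝓡 n, 𝓡 n⟯ sphere (0 : E) 1) :
    Nonempty (M₁ ≃ₘ^∞⟮𝓡 n, 𝓡 n⟯ M) := by
  obtain ⟨i₁, i₂, f₁, f₂, hi₁, hi₂, hf₁, hf₁_inj, hf₂, hf₂_inj, hcover, hglue⟩ := h
  obtain ⟨c, hc⟩ := hi₂.exists_isComplementaryDisc Φ
  have hflip (x : Euc n) (hx0 : x ≠ 0) (hx : ‖x‖ < 1) : f₁ (i₁ x) = f₂ (i₂ (collarFlip x)) :=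
    (hglue _ (hi₁.2.ne hx0) _ (hi₂.2.ne (collarFlip_ne_zero hx0 hx))).mpr
      (glued_collarFlip hx0 hx)
  have hcompl : (i₁ '' ball 0 1)ᶜ ⊆ {i₁ 0}ᶜ := compl_subset_compl.mpr <|
    singleton_subset_iff.mpr <| mem_image_of_mem _ <| mem_ball_self one_pos
  have hd : IsLocalDiffeomorph (𝓡 n) (𝓡 n) ∞ (discReplacement i₁ (f₂ ∘ c) f₁) := by
    refine isLocalDiffeomorph_discReplacement hi₁
      (fun x => (hc.isLocalDiffeomorphOn x).comp _ _ (hf₂ ⟨c x, hc.bijOn.mapsTo x.2⟩))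
      (fun y => hf₁ ⟨y, hcompl y.2⟩) ?_
    filter_upwards [hc.eventuallyEq, eventually_norm_mem_innerCollar one_half_lt_one] with x hx hx'
    rw [Function.comp_apply, hx]
    exact (hflip x (norm_pos_iff.mp (one_half_pos.trans hx'.1)) hx'.2).symm
  have hinj : Function.Injective (discReplacement i₁ (f₂ ∘ c) f₁) :=
    discReplacement_injective hi₁.2 (hf₂_inj.comp hc.bijOn.injOn hc.bijOn.mapsTo)
      (hf₁_inj.mono hcompl) fun x hx y hy h =>
        hy ((hglue y (hcompl hy) _ (hc.bijOn.mapsTo hx)).mp h.symm).mem_image_ball_left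
  have hsurj : range (discReplacement i₁ (f₂ ∘ c) f₁) = univ := by
    rw [range_discReplacement hi₁.2, image_comp, hc.bijOn.image_eq, eq_univ_iff_forall]
    rintro z
    rcases hcover.ge (mem_univ z) with ⟨y, hy, rfl⟩ | hz
    · by_cases hy' : y ∈ i₁ '' ball 0 1
      · obtain ⟨x, hx, rfl⟩ := hy'
        have hx0 : x ≠ 0 := fun h => hy (congrArg i₁ h)
        rw [mem_ball_zero_iff] at hx
        exact Or.inl ⟨_, hi₂.2.ne (collarFlip_ne_zero hx0 hx), (hflip x hx0 hx).symm⟩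
      · exact Or.inr (mem_image_of_mem _ hy')
    · exact Or.inl hz
  exact ⟨hd.diffeomorphOfBijective ⟨hinj, range_eq_univ.mp hsurj⟩⟩

end SphereSummand

end NeckSurgery

theorem mainTheorem9_general {n d : ℕ} [NeZero n] {M : Type*} [TopologicalSpace M] [T2Space M]
    [ConnectedSpace M] [ChartedSpace (NeckSurgery.Euc n) M] [IsManifold (𝓡 n) ∞ M]
    {M' : Type*} [TopologicalSpace M'] [T2Space M'] [ChartedSpace (NeckSurgery.Euc n) M']
    {F : M → NeckSurgery.Euc d} {N : NeckSurgery.Euc n → ℝ → M} {F' : M' → NeckSurgery.Euc d}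
    {Λ τ B : ℝ} (hΛ : 0 < Λ) (hN : NeckSurgery.IsTopologicalNeck N (-(4 * Λ)) (4 * Λ))
    (hS : NeckSurgery.IsStandardSurgery F N Λ τ B F') :
    NeckSurgery.IsSelfConnectedSum n M' M ∧
    (¬ ConnectedSpace M' → ∃ M₁ M₂ : TopologicalSpace.Opens M',
      ConnectedSpace M₁ ∧ ConnectedSpace M₂ ∧ IsCompl M₁ M₂) ∧
    (∀ M₁ M₂ : TopologicalSpace.Opens M', Nonempty M₁ → Nonempty M₂ → IsCompl M₁ M₂ →
      NeckSurgery.IsConnectedSum n M₁ M₂ M ∧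
      (Nonempty (M₂ ≃ₘ^∞⟮𝓡 n, 𝓡 n⟯
          (Metric.sphere (0 : EuclideanSpace ℝ (Fin (n + 1))) 1)) →
        Nonempty (M₁ ≃ₘ^∞⟮𝓡 n, 𝓡 n⟯ M))) := by
  obtain ⟨i₁, i₂, f, h⟩ := hS.exists_isSelfGluing hΛ hN
  refine ⟨h.isSelfConnectedSum, h.exists_isCompl_connectedSpace, fun M₁ M₂ _ _ hM => ?_⟩
  have hsum : NeckSurgery.IsConnectedSum n M₁ M₂ M := h.isConnectedSum_of_isCompl hM
  have : Fact (Module.finrank ℝ (EuclideanSpace ℝ (Fin (n + 1))) = n + 1) :=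
    ⟨finrank_euclideanSpace_fin⟩
  exact ⟨hsum, fun ⟨Φ⟩ => hsum.nonempty_diffeomorph Φ⟩

theorem mainTheorem9 (n : ℕ) (hn : 2 ≤ n) :
    ∃ (ε₀ : ℝ) (k₀ : ℕ), 0 < ε₀ ∧ 1 ≤ k₀ ∧
      ∀ (Λ ε : ℝ) (k : ℕ), 10 ≤ Λ → 0 < ε → ε ≤ ε₀ → k₀ ≤ k →
      ∀ (m : ℕ) (M : Type*) [TopologicalSpace M] [T2Space M] [CompactSpace M] [ConnectedSpace M]
        [ChartedSpace (NeckSurgery.Euc n) M] [IsManifold (𝓡 n) ∞ M]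
        (F : M → NeckSurgery.Euc (n + m)) (N : NeckSurgery.Euc n → ℝ → M),
      NeckSurgery.IsSmoothImmersion (n := n) F →
      NeckSurgery.IsNormalSubmanifoldNeck F N (-(4 * Λ)) (4 * Λ) ε k →
      ∀ (τ B : ℝ), 0 < τ → τ < 1 → 10 * Λ < B →
      ∀ (M' : Type*) [TopologicalSpace M'] [T2Space M'] [CompactSpace M']
        [ChartedSpace (NeckSurgery.Euc n) M'] [IsManifold (𝓡 n) ∞ M']
        (F' : M' → NeckSurgery.Euc (n + m)),
      NeckSurgery.IsSmoothImmersion (n := n) F' →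
      NeckSurgery.IsStandardSurgery F N Λ τ B F' →
      (ConnectedSpace M' → NeckSurgery.IsSelfConnectedSum n M' M) ∧
      (¬ ConnectedSpace M' → ∃ M₁ M₂ : TopologicalSpace.Opens M',
        ConnectedSpace M₁ ∧ ConnectedSpace M₂ ∧ IsCompl M₁ M₂) ∧
      (∀ M₁ M₂ : TopologicalSpace.Opens M',
        ConnectedSpace M₁ → ConnectedSpace M₂ → IsCompl M₁ M₂ →
        NeckSurgery.IsConnectedSum n M₁ M₂ M ∧
        (Nonempty (M₂ ≃ₘ^∞⟮𝓡 n, 𝓡 n⟯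
            (Metric.sphere (0 : EuclideanSpace ℝ (Fin (n + 1))) 1)) →
          Nonempty (M₁ ≃ₘ^∞⟮𝓡 n, 𝓡 n⟯ M))) := by
  refine ⟨1, 1, one_pos, le_rfl, ?_⟩
  intro Λ _ _ hΛ _ _ _ _ M _ _ _ _ _ _ _ N _ hN _ _ _ _ _ M' _ _ _ _ _ _ _ hS
  have : NeZero n := ⟨by omega⟩
  obtain ⟨hself, hcomp, hsum⟩ := mainTheorem9_general (by linarith) hN.topological hS
  exact ⟨fun _ => hself, hcomp, fun M₁ M₂ h₁ h₂ => hsum M₁ M₂ h₁.toNonempty h₂.toNonempty⟩
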